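/- Let $k$ be a commutative ring, $A$ a $k$-algebra and $(U,A,s,t,\Delta,\epsilon)$ a left bialgebroid: $s:A\to U$ and $t:A^{\mathrm{op}}\to U$ are $k$-algebra maps with commuting images, $U$ is an $A$-bimodule by $a\triangleright u\triangleleft b=s(a)t(b)u$, the coproduct $\Delta:U\to U\otimes_AU$, $u\mapsto u_{(1)}\otimes u_{(2)}$ (where $t(a)x\otimes y=x\otimes s(a)y$) and the counit $\epsilon:U\to A$ form an $A$-coring, $\Delta$ is a unital multiplicative map into the Takeuchi product ($u_{(1)}t(a)\otimes u_{(2)}=u_{(1)}\otimes u_{(2)}s(a)$), $\epsilon(1)=1$ and $\epsilon(uv)=\epsilon(u\,s(\epsilon(v)))=\epsilon(u\,t(\epsilon(v)))$. Suppose that $U$ is cocommutative, i.e. equal to its coopposite: $A$ is commutative, $s=t$ and $u_{(2)}\otimes u_{(1)}=u_{(1)}\otimes u_{(2)}$ for all $u\in U$. (1) $U$ is a left Hopf algebroid if and only if it is a right Hopf algebroid. That is, the map $\alpha_\ell(u\otimes v)=u_{(1)}\otimes u_{(2)}v$ (defined on the quotient of $U\otimes_kU$ by $u\,t(a)\otimes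 v=u\otimes t(a)v$, with values in $U\otimes_AU$) is bijective if and only if the map $\alpha_r(u\otimes v)=u_{(1)}v\otimes u_{(2)}$ (defined on the quotient by $u\,s(a)\otimes v=u\otimes s(a)v$, with values in $U\otimes_AU$) is bijective. (2) Suppose that this is the case, and that ${}_\triangleright U$ and $U_\triangleleft$ are finitely generated projective over $A$. Let $U^*$ be the set of $k$-linear $\phi:U\to A$ with $\phi(t(a)u)=\phi(u)a$, with product $(\phi\phi')(u)=\phi'(s(\phi(u_{(1)}))u_{(2)})$, unit $\epsilon$, source $s^*(a)(u)=\epsilon(u\,s(a))$, target $t^*(a)(u)=a\,\epsilon(u)$, counit $\phi\mapsto\phi(1)$ and the coproduct $\phi\mapsto\phi^{(1)}\otimes\phi^{(2)}$ determined by $\phi(uv)=\phi^{(1)}(u\,t(\phi^{(2)}(v)))$. Let $U_*$ be the set of $k$-linear $\psi:U\to A$ with $\psi(s(a)u)=a\psi(u)$, with product $(\psi\psi')(u)=\psi'(t(\psi(u_{(2)}))u_{(1)})$, unit $\epsilon$, source $s_*(a)(u)=\epsilon(u)a$, target $t_*(a)(u)=\epsilon(u\,t(a))$, counit $\psi\mapsto\psi(1)$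 and the coproduct $\psi\mapsto\psi^{(1)}\otimes\psi^{(2)}$ determined by $\psi(uv)=\psi^{(2)}(u\,s(\psi^{(1)}(v)))$. Then $U^*$ and $U_*$ are right bialgebroids over $A$, and $U^*=(U_*)_{\mathrm{coop}}$ (the coopposite exchanges source and target and flips the coproduct). The ring $U^*$ is commutative; with this right bialgebroid structure and its opposite $(U^*,A,t^*,s^*)$, with the same coproduct and counit, as left bialgebroid, $U^*$ is a full Hopf algebroid (in the sense of Böhm and Szlachányi). Its antipode $\mathscr S$ is involutive, $\mathscr S^2=\mathrm{id}$, and under the equality $U^*=U_*$ of sets it is given by $\mathscr S=S^*=S_*$, where $$S^*:U^*\to U_*,\ \ S^*(\phi)(u)=\epsilon\big(u_+\,t(\phi(u_-))\big),\qquad S_*:U_*\to U^*,\ \ S_*(\psi)(u)=\epsilon\big(u_{[+]}\,s(\psi(u_{[-]}))\big),$$ with $u_+\otimes u_-=\alpha_\ell^{-1}(u\otimes1)$ and $u_{[+]}\otimes u_{[-]}=\alpha_r^{-1}(1\otimes u)$. -/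

import Mathlib

open scoped TensorProduct
open MulOpposite (op unop)

noncomputable section

namespace Bgd

section Balanced

variable {k : Type*} [CommRing k] {U : Type*} [AddCommGroup U] [Module k U]
  {ι : Type*} {κ : Type*}

/-- The relations `f i x ⊗ y = x ⊗ g i y` in `U ⊗[k] U`. -/
def balancedRel (f g : ι → U →ₗ[k] U) : Submodule k (U ⊗[k] U) :=
  Submodule.span k {z | ∃ i x y, z = f i x ⊗ₜ[k] y - x ⊗ₜ[k] g i y}

/-- The balanced tensor product: `U ⊗[k] U` modulo `f i x ⊗ y = x ⊗ g i y`.  All tensor products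
`U ⊗_A U` over a (possibly noncommutative) base are of this form, the families `f` and `g` being
the right, respectively left, action of the base which is to be balanced. -/
abbrev BTensor (f g : ι → U →ₗ[k] U) : Type _ := (U ⊗[k] U) ⧸ balancedRel f g

/-- The class of an element of `U ⊗[k] U` in a balanced tensor product. -/
abbrev BTensor.mk (f g : ι → U →ₗ[k] U) : U ⊗[k] U →ₗ[k] BTensor f g := (balancedRel f g).mkQ

/-- The relations of a threefold balanced tensor product: `f, g` balance the first two factors,
`f', g'` the last two. -/
def balancedRel₃ (f g : ι → U →ₗ[k] U) (f' g' : κ → U →ₗ[k] U) :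
    Submodule k (U ⊗[k] (U ⊗[k] U)) :=
  Submodule.span k
    ({w | ∃ i x y z, w = f i x ⊗ₜ[k] (y ⊗ₜ[k] z) - x ⊗ₜ[k] (g i y ⊗ₜ[k] z)} ∪
     {w | ∃ j x y z, w = x ⊗ₜ[k] (f' j y ⊗ₜ[k] z) - x ⊗ₜ[k] (y ⊗ₜ[k] g' j z)})

/-- The threefold balanced tensor product. -/
abbrev BTensor₃ (f g : ι → U →ₗ[k] U) (f' g' : κ → U →ₗ[k] U) : Type _ :=
  (U ⊗[k] (U ⊗[k] U)) ⧸ balancedRel₃ f g f' g'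

theorem BTensor.mk_balanced (f g : ι → U →ₗ[k] U) (i : ι) (x y : U) :
    BTensor.mk f g (f i x ⊗ₜ[k] y) = BTensor.mk f g (x ⊗ₜ[k] g i y) := by
  rw [← sub_eq_zero, ← map_sub, Submodule.mkQ_apply, Submodule.Quotient.mk_eq_zero]
  exact Submodule.subset_span ⟨i, x, y, rfl⟩

theorem balancedRel_le_ker {P : Type*} [AddCommGroup P] [Module k P] (f g : ι → U →ₗ[k] U)
    (h : U ⊗[k] U →ₗ[k] P) (hh : ∀ i x y, h (f i x ⊗ₜ[k] y) = h (x ⊗ₜ[k] g i y)) :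
    balancedRel f g ≤ LinearMap.ker h := by
  refine Submodule.span_le.2 ?_
  rintro _ ⟨i, x, y, rfl⟩
  simp [hh]

/-- `(x ⊗ y) ⊗ z ↦ x ⊗ y ⊗ z`, with `x ⊗ y` in the balanced tensor product. -/
def insertLeft (f g : ι → U →ₗ[k] U) (f' g' : κ → U →ₗ[k] U) :
    BTensor f g →ₗ[k] U →ₗ[k] BTensor₃ f g f' g' :=
  Submodule.liftQ _
    (TensorProduct.curry ((balancedRel₃ f g f' g').mkQ ∘ₗ
      (TensorProduct.assoc k U U U).toLinearMap))
    (balancedRel_le_ker f g _ (fun i x y => by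
      ext z
      simp only [TensorProduct.curry_apply, LinearMap.comp_apply, LinearEquiv.coe_coe,
        TensorProduct.assoc_tmul]
      rw [← sub_eq_zero, ← map_sub, Submodule.mkQ_apply, Submodule.Quotient.mk_eq_zero]
      exact Submodule.subset_span (Or.inl ⟨i, x, y, z, rfl⟩)))

/-- `(y ⊗ z), x ↦ x ⊗ y ⊗ z`, with `y ⊗ z` in the balanced tensor product. -/
def insertRight (f g : ι → U →ₗ[k] U) (f' g' : κ → U →ₗ[k] U) :
    BTensor f' g' →ₗ[k] U →ₗ[k] BTensor₃ f g f' g' :=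
  Submodule.liftQ _ (TensorProduct.curry (balancedRel₃ f g f' g').mkQ).flip
    (balancedRel_le_ker f' g' _ (fun j y z => by
      ext x
      simp only [LinearMap.flip_apply, TensorProduct.curry_apply]
      rw [← sub_eq_zero, ← map_sub, Submodule.mkQ_apply, Submodule.Quotient.mk_eq_zero]
      exact Submodule.subset_span (Or.inr ⟨j, x, y, z, rfl⟩)))

/-- `Δ ⊗ id`, namely `x ⊗ y ↦ Δ x ⊗ y`, on representatives in `U ⊗[k] U`. -/
def comulLeft {f g : ι → U →ₗ[k] U} (Δ : U →ₗ[k] BTensor f g) (f' g' : κ → U →ₗ[k] U) :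
    U ⊗[k] U →ₗ[k] BTensor₃ f g f' g' :=
  TensorProduct.lift (insertLeft f g f' g' ∘ₗ Δ)

/-- `id ⊗ Δ`, namely `x ⊗ y ↦ x ⊗ Δ y`, on representatives in `U ⊗[k] U`. -/
def comulRight (f g : ι → U →ₗ[k] U) {f' g' : κ → U →ₗ[k] U} (Δ : U →ₗ[k] BTensor f' g') :
    U ⊗[k] U →ₗ[k] BTensor₃ f g f' g' :=
  TensorProduct.lift (insertRight f g f' g' ∘ₗ Δ).flip

end Balanced

section Structures

variable (k : Type*) [CommRing k] (A : Type*) [Ring A] [Algebra k A]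
  (U : Type*) [Ring U] [Algebra k U]

/-- The structure maps of a left bialgebroid over `A`.  The coproduct takes values in the
tensor product `U ⊗_A U` in which `t(a) x ⊗ y = x ⊗ s(a) y`. -/
structure LeftBialgebroidData where
  source : A →ₐ[k] U
  target : Aᵐᵒᵖ →ₐ[k] U
  comul : U →ₗ[k] BTensor (fun a : A => LinearMap.mulLeft k (target (op a)))
    (fun a : A => LinearMap.mulLeft k (source a))
  counit : U →ₗ[k] A

/-- The structure maps of a right bialgebroid over `A`.  The coproduct takes values in the
tensor product `U ⊗_A U` in which `x s(a) ⊗ y = x ⊗ y t(a)`. -/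
structure RightBialgebroidData where
  source : A →ₐ[k] U
  target : Aᵐᵒᵖ →ₐ[k] U
  comul : U →ₗ[k] BTensor (fun a : A => LinearMap.mulRight k (source a))
    (fun a : A => LinearMap.mulRight k (target (op a)))
  counit : U →ₗ[k] A

variable {k A U}

/-- The projection `U ⊗[k] U → U ⊗_A U` onto the codomain of the coproduct. -/
abbrev LeftBialgebroidData.mk₂ (D : LeftBialgebroidData k A U) :=
  BTensor.mk (fun a : A => LinearMap.mulLeft k (D.target (op a)))
    (fun a : A => LinearMap.mulLeft k (D.source a))

/-- The projection `U ⊗[k] U → U ⊗_A U` onto the codomain of the coproduct. -/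
abbrev RightBialgebroidData.mk₂ (D : RightBialgebroidData k A U) :=
  BTensor.mk (fun a : A => LinearMap.mulRight k (D.source a))
    (fun a : A => LinearMap.mulRight k (D.target (op a)))

variable (k A U)

/-- Left bialgebroids over `A`.  Identities involving the coproduct are expressed through
representatives `p : U ⊗[k] U` of `Δ u`; such representatives always exist, and
the identities do not depend on their choice. -/
structure LeftBialgebroid extends LeftBialgebroidData k A U where
  source_mul_target : ∀ a b, source a * target (op b) = target (op b) * source a
  /-- `Δ (s(a) t(b) u) = s(a) u₁ ⊗ t(b) u₂` -/
  comul_bimodule : ∀ a b u p, toLeftBialgebroidData.mk₂ p = comul u →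
    comul (source a * target (op b) * u) =
      toLeftBialgebroidData.mk₂ ((source a ⊗ₜ[k] target (op b)) * p)
  /-- `ε (s(a) t(b) u) = a ε(u) b` -/
  counit_bimodule : ∀ a b u, counit (source a * target (op b) * u) = a * counit u * b
  /-- `(Δ ⊗ id) Δ = (id ⊗ Δ) Δ` in `U ⊗_A U ⊗_A U` -/
  coassoc : ∀ u p, toLeftBialgebroidData.mk₂ p = comul u →
    comulLeft comul (fun a : A => LinearMap.mulLeft k (target (op a)))
        (fun a : A => LinearMap.mulLeft k (source a)) p =
      comulRight (fun a : A => LinearMap.mulLeft k (target (op a)))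
        (fun a : A => LinearMap.mulLeft k (source a)) comul p
  /-- `s(ε(u₁)) u₂ = u` -/
  counit_comul : ∀ u p, toLeftBialgebroidData.mk₂ p = comul u →
    LinearMap.mul' k U (TensorProduct.map (source.toLinearMap ∘ₗ counit) LinearMap.id p) = u
  /-- `t(ε(u₂)) u₁ = u` -/
  comul_counit : ∀ u p, toLeftBialgebroidData.mk₂ p = comul u →
    LinearMap.mul' k U (TensorProduct.map
      (target.toLinearMap ∘ₗ (MulOpposite.opLinearEquiv k).toLinearMap ∘ₗ counit) LinearMap.id
      (TensorProduct.comm k U U p)) = u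
  /-- the coproduct takes values in the Takeuchi product: `u₁ t(a) ⊗ u₂ = u₁ ⊗ u₂ s(a)` -/
  takeuchi : ∀ a u p, toLeftBialgebroidData.mk₂ p = comul u →
    toLeftBialgebroidData.mk₂ (p * (target (op a) ⊗ₜ[k] 1)) =
      toLeftBialgebroidData.mk₂ (p * (1 ⊗ₜ[k] source a))
  comul_one : comul 1 = toLeftBialgebroidData.mk₂ 1
  /-- `Δ (u v) = u₁ v₁ ⊗ u₂ v₂` -/
  comul_mul : ∀ u v p q, toLeftBialgebroidData.mk₂ p = comul u →
    toLeftBialgebroidData.mk₂ q = comul v → comul (u * v) = toLeftBialgebroidData.mk₂ (p * q)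
  counit_one : counit 1 = 1
  counit_mul_source : ∀ u v, counit (u * v) = counit (u * source (counit v))
  counit_mul_target : ∀ u v, counit (u * v) = counit (u * target (op (counit v)))

/-- Right bialgebroids over `A`, with the same conventions on representatives. -/
structure RightBialgebroid extends RightBialgebroidData k A U where
  source_mul_target : ∀ a b, source a * target (op b) = target (op b) * source a
  /-- `Δ (v t(a) s(b)) = v₁ t(a) ⊗ v₂ s(b)` -/
  comul_bimodule : ∀ a b v p, toRightBialgebroidData.mk₂ p = comul v →
    comul (v * (target (op a) * source b)) =
      toRightBialgebroidData.mk₂ (p * (target (op a) ⊗ₜ[k] source b))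
  /-- `∂ (v t(a) s(b)) = a ∂(v) b` -/
  counit_bimodule : ∀ a b v, counit (v * (target (op a) * source b)) = a * counit v * b
  /-- `(Δ ⊗ id) Δ = (id ⊗ Δ) Δ` in `U ⊗_A U ⊗_A U` -/
  coassoc : ∀ v p, toRightBialgebroidData.mk₂ p = comul v →
    comulLeft comul (fun a : A => LinearMap.mulRight k (source a))
        (fun a : A => LinearMap.mulRight k (target (op a))) p =
      comulRight (fun a : A => LinearMap.mulRight k (source a))
        (fun a : A => LinearMap.mulRight k (target (op a))) comul p
  /-- `v₂ t(∂(v₁)) = v` -/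
  counit_comul : ∀ v p, toRightBialgebroidData.mk₂ p = comul v →
    LinearMap.mul' k U (TensorProduct.map LinearMap.id
      (target.toLinearMap ∘ₗ (MulOpposite.opLinearEquiv k).toLinearMap ∘ₗ counit)
      (TensorProduct.comm k U U p)) = v
  /-- `v₁ s(∂(v₂)) = v` -/
  comul_counit : ∀ v p, toRightBialgebroidData.mk₂ p = comul v →
    LinearMap.mul' k U (TensorProduct.map LinearMap.id (source.toLinearMap ∘ₗ counit) p) = v
  /-- the coproduct takes values in the Takeuchi product: `s(a) v₁ ⊗ v₂ = v₁ ⊗ t(a) v₂` -/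
  takeuchi : ∀ a v p, toRightBialgebroidData.mk₂ p = comul v →
    toRightBialgebroidData.mk₂ ((source a ⊗ₜ[k] 1) * p) =
      toRightBialgebroidData.mk₂ ((1 ⊗ₜ[k] target (op a)) * p)
  comul_one : comul 1 = toRightBialgebroidData.mk₂ 1
  /-- `Δ (v w) = v₁ w₁ ⊗ v₂ w₂` -/
  comul_mul : ∀ v w p q, toRightBialgebroidData.mk₂ p = comul v →
    toRightBialgebroidData.mk₂ q = comul w → comul (v * w) = toRightBialgebroidData.mk₂ (p * q)
  counit_one : counit 1 = 1
  counit_mul_source : ∀ v w, counit (v * w) = counit (source (counit v) * w)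
  counit_mul_target : ∀ v w, counit (v * w) = counit (target (op (counit v)) * w)

end Structures

/-- Full Hopf algebroids in the sense of Böhm and Szlachányi: a left bialgebroid over `A`
and a right bialgebroid over `B` on the same `k`-algebra `H`, and an antipode. -/
structure FullHopfAlgebroid (k : Type*) [CommRing k] (A : Type*) [Ring A] [Algebra k A]
    (B : Type*) [Ring B] [Algebra k B] (H : Type*) [Ring H] [Algebra k H] where
  left : LeftBialgebroid k A H
  right : RightBialgebroid k B H
  antipode : H →ₗ[k] H
  source_counit_target : ∀ b, left.source (left.counit (right.target (op b))) = right.target (op b)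
  target_counit_source : ∀ b, left.target (op (left.counit (right.source b))) = right.source b
  source_counit_target' : ∀ a, right.source (right.counit (left.target (op a))) = left.target (op a)
  target_counit_source' : ∀ a, right.target (op (right.counit (left.source a))) = left.source a
  /-- `(Δ_L ⊗_B id) Δ_R = (id ⊗_A Δ_R) Δ_L` in `H ⊗_A H ⊗_B H` -/
  coassoc_left_right : ∀ h p q, right.mk₂ p = right.comul h → left.mk₂ q = left.comul h →
    comulLeft left.comul (fun b : B => LinearMap.mulRight k (right.source b))
        (fun b : B => LinearMap.mulRight k (right.target (op b))) p =
      comulRight (fun a : A => LinearMap.mulLeft k (left.target (op a)))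
        (fun a : A => LinearMap.mulLeft k (left.source a)) right.comul q
  /-- `(Δ_R ⊗_A id) Δ_L = (id ⊗_B Δ_L) Δ_R` in `H ⊗_B H ⊗_A H` -/
  coassoc_right_left : ∀ h p q, left.mk₂ p = left.comul h → right.mk₂ q = right.comul h →
    comulLeft right.comul (fun a : A => LinearMap.mulLeft k (left.target (op a)))
        (fun a : A => LinearMap.mulLeft k (left.source a)) p =
      comulRight (fun b : B => LinearMap.mulRight k (right.source b))
        (fun b : B => LinearMap.mulRight k (right.target (op b))) left.comul q
  antipode_bimodule : ∀ a b h, antipode (left.target (op a) * h * right.target (op b)) =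
    right.source b * antipode h * left.source a
  /-- `S(h₁) h₂ = s_R(∂(h))`, for the left coproduct -/
  antipode_mul : ∀ h p, left.mk₂ p = left.comul h →
    LinearMap.mul' k H (TensorProduct.map antipode LinearMap.id p) = right.source (right.counit h)
  /-- `h₁ S(h₂) = s_L(ε(h))`, for the right coproduct -/
  mul_antipode : ∀ h p, right.mk₂ p = right.comul h →
    LinearMap.mul' k H (TensorProduct.map LinearMap.id antipode p) = left.source (left.counit h)

namespace RightBialgebroidData

variable {k : Type*} [CommRing k] {A : Type*} [Ring A] [Algebra k A]
  {U : Type*} [Ring U] [Algebra k U] {A' : Type*} [Ring A'] [Algebra k A']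
  {U' : Type*} [Ring U'] [Algebra k U']

/-- The coopposite `(U, A^op, t, s, Δ^coop, ∂)` of a right bialgebroid. -/
def coop (D : RightBialgebroidData k A U) : RightBialgebroidData k Aᵐᵒᵖ U where
  source := D.target
  target := D.source.comp (AlgEquiv.opOp k A).symm.toAlgHom
  comul := Submodule.liftQ _
    (BTensor.mk (fun a : Aᵐᵒᵖ => LinearMap.mulRight k (D.target a))
        (fun a : Aᵐᵒᵖ => LinearMap.mulRight k
          (D.source.comp (AlgEquiv.opOp k A).symm.toAlgHom (op a))) ∘ₗ
      (TensorProduct.comm k U U).toLinearMap)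
    (balancedRel_le_ker _ _ _ (fun a x y => by
      exact (BTensor.mk_balanced (fun a : Aᵐᵒᵖ => LinearMap.mulRight k (D.target a))
        (fun a : Aᵐᵒᵖ => LinearMap.mulRight k
          (D.source.comp (AlgEquiv.opOp k A).symm.toAlgHom (op a))) (op a) y x).symm)) ∘ₗ
    D.comul
  counit := (MulOpposite.opLinearEquiv k).toLinearMap ∘ₗ D.counit

/-- A commutative right bialgebroid `(U, A, s, t, Δ, ∂)` seen as a left bialgebroid: its opposite
`(U^op, A, t, s, Δ, ∂)`, where `U^op = U`. -/
def oppositeOfComm (D : RightBialgebroidData k A U) (hU : ∀ x y : U, x * y = y * x) :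
    LeftBialgebroidData k A U where
  source := AlgHom.ofLinearMap (D.target.toLinearMap ∘ₗ (MulOpposite.opLinearEquiv k).toLinearMap)
    (by simp) (fun a b => by simp [hU (D.target (op b))])
  target := AlgHom.ofLinearMap
    (D.source.toLinearMap ∘ₗ (MulOpposite.opLinearEquiv k).symm.toLinearMap)
    (by simp) (fun a b => by simp [hU (D.source (unop b))])
  comul := Submodule.liftQ _ (BTensor.mk _ _) (balancedRel_le_ker _ _ _ (fun a x y => by
      rw [LinearMap.mulRight_apply, LinearMap.mulRight_apply, hU x, hU y]
      exact BTensor.mk_balanced (k := k) (fun a : A => LinearMap.mulLeft k (D.source a))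
        (fun a : A => LinearMap.mulLeft k (D.target (op a))) a x y)) ∘ₗ D.comul
  counit := D.counit

/-- `(F, f)` is a morphism of right bialgebroids `(U, A) → (U', A')`. -/
structure IsHom (D : RightBialgebroidData k A U) (D' : RightBialgebroidData k A' U')
    (F : U →ₐ[k] U') (f : A →ₐ[k] A') : Prop where
  source : ∀ a, F (D.source a) = D'.source (f a)
  target : ∀ a, F (D.target (op a)) = D'.target (op (f a))
  counit : ∀ u, D'.counit (F u) = f (D.counit u)
  comul : ∀ u p, D.mk₂ p = D.comul u →
    D'.comul (F u) = D'.mk₂ (TensorProduct.map F.toLinearMap F.toLinearMap p)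

end RightBialgebroidData

namespace LeftBialgebroid

variable {k : Type*} [CommRing k] {A : Type*} [Ring A] [Algebra k A]
  {U : Type*} [Ring U] [Algebra k U] (B : LeftBialgebroid k A U)

/-- Cocommutativity: the left bialgebroid agrees with its coopposite `(U, A^op, t, s, Δ^coop, ε)`,
that is, `A` is commutative, `s = t`, and `u₂ ⊗ u₁ = u₁ ⊗ u₂`. -/
structure IsCocommutative : Prop where
  base_comm : ∀ a b : A, a * b = b * a
  source_eq_target : ∀ a, B.source a = B.target (op a)
  comul_comm : ∀ u p, B.mk₂ p = B.comul u → B.mk₂ (TensorProduct.comm k U U p) = B.comul u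

/-- `U` with `a ▷ u = s(a) u` is finitely generated projective over `A`. -/
def LeftFGProjective : Prop :=
  letI : Module A U := Module.compHom U (B.source : A →+* U)
  Module.Finite A U ∧ Module.Projective A U

/-- `U` with `u ◁ a = t(a) u` is finitely generated projective as a right `A`-module. -/
def RightFGProjective : Prop :=
  letI : Module Aᵐᵒᵖ U := Module.compHom U (B.target : Aᵐᵒᵖ →+* U)
  Module.Finite Aᵐᵒᵖ U ∧ Module.Projective Aᵐᵒᵖ U

/-! ### Elementary identities -/

theorem exists_rep (u : U) : ∃ p, B.mk₂ p = B.comul u :=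
  Submodule.mkQ_surjective _ _

theorem comul_target (a : A) : B.comul (B.target (op a)) = B.mk₂ (1 ⊗ₜ[k] B.target (op a)) := by
  have h := B.comul_bimodule 1 a 1 1 B.comul_one.symm
  simpa using h

theorem comul_source (a : A) : B.comul (B.source a) = B.mk₂ (B.source a ⊗ₜ[k] 1) := by
  have h := B.comul_bimodule a 1 1 1 B.comul_one.symm
  simpa using h

/-! ### The Hopf-Galois maps -/

/-- `U ⊗_A U` as a right module over `U ⊗[k] U`. -/
def rightAct : BTensor (fun a : A => LinearMap.mulLeft k (B.target (op a)))
    (fun a : A => LinearMap.mulLeft k (B.source a)) →ₗ[k] U ⊗[k] U →ₗ[k]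
    BTensor (fun a : A => LinearMap.mulLeft k (B.target (op a)))
    (fun a : A => LinearMap.mulLeft k (B.source a)) :=
  Submodule.liftQ _ ((LinearMap.mul k (U ⊗[k] U)).compr₂ B.mk₂)
    (balancedRel_le_ker _ _ _ (fun a x y => by
      refine TensorProduct.ext' (fun v w => ?_)
      simpa [mul_assoc] using BTensor.mk_balanced
        (fun a : A => LinearMap.mulLeft k (B.target (op a)))
        (fun a : A => LinearMap.mulLeft k (B.source a)) a (x * v) (y * w)))

theorem rightAct_mk (p q : U ⊗[k] U) : B.rightAct (B.mk₂ p) q = B.mk₂ (p * q) := rfl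

theorem rightAct_comul_mul (u v : U) (p q : U ⊗[k] U) (hq : B.mk₂ q = B.comul v) :
    B.rightAct (B.comul (u * v)) p = B.rightAct (B.comul u) (q * p) := by
  obtain ⟨r, hr⟩ := B.exists_rep u
  rw [B.comul_mul u v r q hr hq, ← hr, rightAct_mk, rightAct_mk, mul_assoc]

/-- The tensor product in which `u t(a) ⊗ v = u ⊗ t(a) v`. -/
abbrev HopfSource := BTensor (fun a : A => LinearMap.mulRight k (B.target (op a)))
  (fun a : A => LinearMap.mulLeft k (B.target (op a)))

/-- The tensor product in which `u s(a) ⊗ v = u ⊗ s(a) v`. -/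
abbrev HopfSource' := BTensor (fun a : A => LinearMap.mulRight k (B.source a))
  (fun a : A => LinearMap.mulLeft k (B.source a))

/-- `α_ℓ (u ⊗ v) = u₁ ⊗ u₂ v` -/
def galoisLeft : B.HopfSource →ₗ[k] BTensor (fun a : A => LinearMap.mulLeft k (B.target (op a)))
    (fun a : A => LinearMap.mulLeft k (B.source a)) :=
  Submodule.liftQ _
    (TensorProduct.lift ((B.rightAct ∘ₗ B.comul).compl₂ (TensorProduct.mk k U U 1)))
    (balancedRel_le_ker _ _ _ (fun a x y => by
      simp only [TensorProduct.lift.tmul, LinearMap.compl₂_apply, LinearMap.comp_apply,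
        LinearMap.mulRight_apply, LinearMap.mulLeft_apply, TensorProduct.mk_apply]
      rw [B.rightAct_comul_mul _ _ _ _ (B.comul_target a).symm]
      simp))

/-- `α_r (u ⊗ v) = u₁ v ⊗ u₂` -/
def galoisRight : B.HopfSource' →ₗ[k] BTensor (fun a : A => LinearMap.mulLeft k (B.target (op a)))
    (fun a : A => LinearMap.mulLeft k (B.source a)) :=
  Submodule.liftQ _
    (TensorProduct.lift ((B.rightAct ∘ₗ B.comul).compl₂ ((TensorProduct.mk k U U).flip 1)))
    (balancedRel_le_ker _ _ _ (fun a x y => by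
      simp only [TensorProduct.lift.tmul, LinearMap.compl₂_apply, LinearMap.comp_apply,
        LinearMap.mulRight_apply, LinearMap.mulLeft_apply, TensorProduct.mk_apply,
        LinearMap.flip_apply]
      rw [B.rightAct_comul_mul _ _ _ _ (B.comul_source a).symm]
      simp))

/-- A left bialgebroid is a left Hopf algebroid if `α_ℓ` is bijective. -/
def IsLeftHopf : Prop := Function.Bijective B.galoisLeft

/-- A left bialgebroid is a right Hopf algebroid if `α_r` is bijective. -/
def IsRightHopf : Prop := Function.Bijective B.galoisRight

variable {B} in
/-- The translation map `u ↦ u₊ ⊗ u₋ = α_ℓ⁻¹ (u ⊗ 1)`. -/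
def IsLeftHopf.translation (h : B.IsLeftHopf) : U →ₗ[k] B.HopfSource :=
  (LinearEquiv.ofBijective B.galoisLeft h).symm.toLinearMap ∘ₗ B.mk₂ ∘ₗ
    (TensorProduct.mk k U U).flip 1

variable {B} in
/-- The translation map `u ↦ u₍₊₎ ⊗ u₍₋₎ = α_r⁻¹ (1 ⊗ u)`. -/
def IsRightHopf.translation (h : B.IsRightHopf) : U →ₗ[k] B.HopfSource' :=
  (LinearEquiv.ofBijective B.galoisRight h).symm.toLinearMap ∘ₗ B.mk₂ ∘ₗ
    TensorProduct.mk k U U 1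

/-! ### The duals as rings -/

/-- The left dual `U_*`: maps `ψ : U → A` with `ψ (s(a) u) = a ψ(u)`. -/
def leftDual : Submodule k (U →ₗ[k] A) where
  carrier := {ψ | ∀ a u, ψ (B.source a * u) = a * ψ u}
  add_mem' h h' a u := by simp [h a u, h' a u, mul_add]
  zero_mem' a u := by simp
  smul_mem' c ψ h a u := by simp [h a u]

/-- The right dual `U^*`: maps `φ : U → A` with `φ (t(a) u) = φ(u) a`. -/
def rightDual : Submodule k (U →ₗ[k] A) where
  carrier := {φ | ∀ a u, φ (B.target (op a) * u) = φ u * a}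
  add_mem' h h' a u := by simp [h a u, h' a u, add_mul]
  zero_mem' a u := by simp
  smul_mem' c ψ h a u := by simp [h a u]

theorem counit_source_mul (a : A) (u : U) : B.counit (B.source a * u) = a * B.counit u := by
  simpa using B.counit_bimodule a 1 u

theorem counit_target_mul (a : A) (u : U) :
    B.counit (B.target (op a) * u) = B.counit u * a := by
  simpa using B.counit_bimodule 1 a u

variable {B}

theorem leftDual_apply (ψ : B.leftDual) (a : A) (u : U) :
    ψ.1 (B.source a * u) = a * ψ.1 u := ψ.2 a u

theorem rightDual_apply (φ : B.rightDual) (a : A) (u : U) :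
    φ.1 (B.target (op a) * u) = φ.1 u * a := φ.2 a u

/-- `x ⊗ y ↦ s(φ(x)) y` -/
def rightContract (φ : B.rightDual) : U ⊗[k] U →ₗ[k] U :=
  LinearMap.mul' k U ∘ₗ TensorProduct.map (B.source.toLinearMap ∘ₗ φ.1) LinearMap.id

/-- `x ⊗ y ↦ t(ψ(y)) x` -/
def leftContract (ψ : B.leftDual) : U ⊗[k] U →ₗ[k] U :=
  LinearMap.mul' k U ∘ₗ TensorProduct.map (B.target.toLinearMap ∘ₗ
    (MulOpposite.opLinearEquiv k).toLinearMap ∘ₗ ψ.1) LinearMap.id ∘ₗ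
    (TensorProduct.comm k U U).toLinearMap

@[simp] theorem rightContract_tmul (φ : B.rightDual) (x y : U) :
    rightContract φ (x ⊗ₜ y) = B.source (φ.1 x) * y := by simp [rightContract]

@[simp] theorem leftContract_tmul (ψ : B.leftDual) (x y : U) :
    leftContract ψ (x ⊗ₜ y) = B.target (op (ψ.1 y)) * x := by simp [leftContract]

/-- `u ↦ s(φ(u₁)) u₂` -/
def rightHit (φ : B.rightDual) : U →ₗ[k] U :=
  Submodule.liftQ _ (rightContract φ) (balancedRel_le_ker _ _ _ (fun a x y => by
    simp [rightDual_apply, mul_assoc])) ∘ₗ B.comul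

/-- `u ↦ t(ψ(u₂)) u₁` -/
def leftHit (ψ : B.leftDual) : U →ₗ[k] U :=
  Submodule.liftQ _ (leftContract ψ) (balancedRel_le_ker _ _ _ (fun a x y => by
    simp [leftDual_apply, mul_assoc])) ∘ₗ B.comul

theorem rightHit_eq (φ : B.rightDual) {u : U} {p : U ⊗[k] U} (hp : B.mk₂ p = B.comul u) :
    rightHit φ u = rightContract φ p := by
  rw [rightHit, LinearMap.comp_apply, ← hp]; rfl

theorem leftHit_eq (ψ : B.leftDual) {u : U} {p : U ⊗[k] U} (hp : B.mk₂ p = B.comul u) :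
    leftHit ψ u = leftContract ψ p := by
  rw [leftHit, LinearMap.comp_apply, ← hp]; rfl

theorem rightHit_target_mul (φ : B.rightDual) (a : A) (u : U) :
    rightHit φ (B.target (op a) * u) = B.target (op a) * rightHit φ u := by
  obtain ⟨p, hp⟩ := B.exists_rep u
  have h := B.comul_bimodule 1 a u p hp
  simp only [map_one, one_mul] at h
  rw [rightHit_eq φ h.symm, rightHit_eq φ hp]
  clear h hp
  induction p with
  | zero => simp
  | add p q hp hq => rw [mul_add, map_add, map_add, hp, hq, mul_add]
  | tmul x y =>
    simp only [Algebra.TensorProduct.tmul_mul_tmul, rightContract_tmul, one_mul, ← mul_assoc,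
      B.source_mul_target]

theorem rightHit_source_mul (φ : B.rightDual) (a : A) (u : U) {p : U ⊗[k] U}
    (hp : B.mk₂ p = B.comul u) :
    rightHit φ (B.source a * u) = rightContract φ ((B.source a ⊗ₜ[k] 1) * p) := by
  have h := B.comul_bimodule a 1 u p hp
  simp only [MulOpposite.op_one, map_one, mul_one] at h
  rw [rightHit_eq φ h.symm]

theorem leftHit_source_mul (ψ : B.leftDual) (a : A) (u : U) :
    leftHit ψ (B.source a * u) = B.source a * leftHit ψ u := by
  obtain ⟨p, hp⟩ := B.exists_rep u
  have h := B.comul_bimodule a 1 u p hp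
  simp only [MulOpposite.op_one, map_one, mul_one] at h
  rw [leftHit_eq ψ h.symm, leftHit_eq ψ hp]
  clear h hp
  induction p with
  | zero => simp
  | add p q hp hq => rw [mul_add, map_add, map_add, hp, hq, mul_add]
  | tmul x y =>
    simp only [Algebra.TensorProduct.tmul_mul_tmul, leftContract_tmul, one_mul, ← mul_assoc,
      B.source_mul_target]

theorem leftHit_target_mul (ψ : B.leftDual) (a : A) (u : U) {p : U ⊗[k] U}
    (hp : B.mk₂ p = B.comul u) :
    leftHit ψ (B.target (op a) * u) = leftContract ψ ((1 ⊗ₜ[k] B.target (op a)) * p) := by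
  have h := B.comul_bimodule 1 a u p hp
  simp only [map_one, one_mul] at h
  rw [leftHit_eq ψ h.symm]

/-- The product `(φ φ')(u) = φ'(s(φ(u₁)) u₂)` of the right dual. -/
instance : Mul B.rightDual where
  mul φ φ' := ⟨φ'.1 ∘ₗ rightHit φ, fun a u => by
    rw [LinearMap.comp_apply, rightHit_target_mul, rightDual_apply]; rfl⟩

/-- The product `(ψ ψ')(u) = ψ'(t(ψ(u₂)) u₁)` of the left dual. -/
instance : Mul B.leftDual where
  mul ψ ψ' := ⟨ψ'.1 ∘ₗ leftHit ψ, fun a u => by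
    rw [LinearMap.comp_apply, leftHit_source_mul, leftDual_apply]; rfl⟩

/-- The counit is the unit of the right dual. -/
instance : One B.rightDual where
  one := ⟨B.counit, B.counit_target_mul⟩

/-- The counit is the unit of the left dual. -/
instance : One B.leftDual where
  one := ⟨B.counit, B.counit_source_mul⟩

theorem rightDual_mul_apply (φ φ' : B.rightDual) (u : U) : (φ * φ').1 u = φ'.1 (rightHit φ u) := rfl

theorem leftDual_mul_apply (ψ ψ' : B.leftDual) (u : U) : (ψ * ψ').1 u = ψ'.1 (leftHit ψ u) := rfl

theorem rightHit_mul (φ φ' : B.rightDual) (u : U) :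
    rightHit (φ * φ') u = rightHit φ' (rightHit φ u) := by
  let G : BTensor₃ (fun a : A => LinearMap.mulLeft k (B.target (op a)))
    (fun a : A => LinearMap.mulLeft k (B.source a))
    (fun a : A => LinearMap.mulLeft k (B.target (op a)))
    (fun a : A => LinearMap.mulLeft k (B.source a)) →ₗ[k] U :=
    Submodule.liftQ _ (rightContract φ' ∘ₗ TensorProduct.map (rightContract φ) LinearMap.id ∘ₗ
      (TensorProduct.assoc k U U U).symm.toLinearMap) (by
        refine Submodule.span_le.2 ?_
        rintro _ (⟨a, x, y, z, rfl⟩ | ⟨a, x, y, z, rfl⟩)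
        · simp [rightDual_apply, mul_assoc]
        · simp only [LinearMap.mulLeft_apply, SetLike.mem_coe, LinearMap.mem_ker, map_sub,
            LinearMap.comp_apply, LinearEquiv.coe_coe, TensorProduct.assoc_symm_tmul,
            TensorProduct.map_tmul, rightContract_tmul, LinearMap.id_apply]
          rw [← mul_assoc, B.source_mul_target, mul_assoc, rightDual_apply, map_mul B.source]
          simp [mul_assoc])
  obtain ⟨p, hp⟩ := B.exists_rep u
  rw [rightHit_eq _ hp, rightHit_eq φ hp]
  have h1 : ∀ p : U ⊗[k] U, rightContract (φ * φ') p = G (comulLeft B.comul _ _ p) := by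
    intro p
    induction p with
    | zero => simp
    | add p q hp hq => rw [map_add, map_add, map_add, hp, hq]
    | tmul x y =>
      obtain ⟨q, hq⟩ := B.exists_rep x
      rw [rightContract_tmul, rightDual_mul_apply, rightHit_eq φ hq, comulLeft,
        TensorProduct.lift.tmul, LinearMap.comp_apply, ← hq]
      change _ = rightContract φ' (TensorProduct.map (rightContract φ) LinearMap.id
        ((TensorProduct.assoc k U U U).symm ((TensorProduct.assoc k U U U) (q ⊗ₜ y))))
      rw [LinearEquiv.symm_apply_apply]
      simp
  have h2 : ∀ p : U ⊗[k] U,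
      rightHit φ' (rightContract φ p) = G (comulRight _ _ B.comul p) := by
    intro p
    induction p with
    | zero => simp
    | add p q hp hq => rw [map_add, map_add, map_add, map_add, hp, hq]
    | tmul x y =>
      obtain ⟨q, hq⟩ := B.exists_rep y
      rw [rightContract_tmul, rightHit_source_mul φ' _ _ hq, comulRight,
        TensorProduct.lift.tmul, LinearMap.flip_apply, LinearMap.comp_apply, ← hq]
      change _ = rightContract φ' (TensorProduct.map (rightContract φ) LinearMap.id
        ((TensorProduct.assoc k U U U).symm (x ⊗ₜ q)))
      clear hq
      induction q with
      | zero => simp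
      | add p q hp hq => rw [mul_add, map_add, hp, hq, TensorProduct.tmul_add]; simp
      | tmul y z => simp
  rw [h1, h2, B.coassoc u p hp]

theorem leftHit_mul (ψ ψ' : B.leftDual) (u : U) :
    leftHit (ψ * ψ') u = leftHit ψ' (leftHit ψ u) := by
  let G : BTensor₃ (fun a : A => LinearMap.mulLeft k (B.target (op a)))
    (fun a : A => LinearMap.mulLeft k (B.source a))
    (fun a : A => LinearMap.mulLeft k (B.target (op a)))
    (fun a : A => LinearMap.mulLeft k (B.source a)) →ₗ[k] U :=
    Submodule.liftQ _ (leftContract ψ' ∘ₗ TensorProduct.map LinearMap.id (leftContract ψ)) (by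
        refine Submodule.span_le.2 ?_
        rintro _ (⟨a, x, y, z, rfl⟩ | ⟨a, x, y, z, rfl⟩)
        · simp only [LinearMap.mulLeft_apply, SetLike.mem_coe, LinearMap.mem_ker, map_sub,
            LinearMap.comp_apply, TensorProduct.map_tmul, leftContract_tmul, LinearMap.id_apply]
          rw [← mul_assoc (B.target _) (B.source a) y, ← B.source_mul_target, mul_assoc,
            leftDual_apply, MulOpposite.op_mul, map_mul B.target]
          simp [mul_assoc]
        · simp [leftDual_apply, mul_assoc])
  obtain ⟨p, hp⟩ := B.exists_rep u
  rw [leftHit_eq _ hp, leftHit_eq ψ hp]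
  have h1 : ∀ p : U ⊗[k] U, leftContract (ψ * ψ') p = G (comulRight _ _ B.comul p) := by
    intro p
    induction p with
    | zero => simp
    | add p q hp hq => rw [map_add, map_add, map_add, hp, hq]
    | tmul x y =>
      obtain ⟨q, hq⟩ := B.exists_rep y
      rw [leftContract_tmul, leftDual_mul_apply, leftHit_eq ψ hq, comulRight,
        TensorProduct.lift.tmul, LinearMap.flip_apply, LinearMap.comp_apply, ← hq]
      change _ = leftContract ψ' (TensorProduct.map LinearMap.id (leftContract ψ) (x ⊗ₜ q))
      simp
  have h2 : ∀ p : U ⊗[k] U,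
      leftHit ψ' (leftContract ψ p) = G (comulLeft B.comul _ _ p) := by
    intro p
    induction p with
    | zero => simp
    | add p q hp hq => rw [map_add, map_add, map_add, map_add, hp, hq]
    | tmul x y =>
      obtain ⟨q, hq⟩ := B.exists_rep x
      rw [leftContract_tmul, leftHit_target_mul ψ' _ _ hq, comulLeft,
        TensorProduct.lift.tmul, LinearMap.comp_apply, ← hq]
      change _ = leftContract ψ' (TensorProduct.map LinearMap.id (leftContract ψ)
        ((TensorProduct.assoc k U U U) (q ⊗ₜ y)))
      clear hq
      induction q with
      | zero => simp
      | add p q hp hq => rw [mul_add, map_add, hp, hq, TensorProduct.add_tmul]; simp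
      | tmul x z => simp
  rw [h1, h2, B.coassoc u p hp]

theorem rightHit_one (u : U) : rightHit (1 : B.rightDual) u = u := by
  obtain ⟨p, hp⟩ := B.exists_rep u
  rw [rightHit_eq _ hp]
  exact B.counit_comul u p hp

theorem leftHit_one (u : U) : leftHit (1 : B.leftDual) u = u := by
  obtain ⟨p, hp⟩ := B.exists_rep u
  rw [leftHit_eq _ hp]
  exact B.comul_counit u p hp

theorem counit_rightHit (φ : B.rightDual) (u : U) : B.counit (rightHit φ u) = φ.1 u := by
  obtain ⟨p, hp⟩ := B.exists_rep u
  rw [rightHit_eq _ hp]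
  conv_rhs => rw [← B.comul_counit u p hp]
  clear hp
  induction p with
  | zero => simp
  | add p q hp hq => rw [map_add, map_add, hp, hq]; simp only [map_add]
  | tmul x y => simp [counit_source_mul, rightDual_apply]

theorem counit_leftHit (ψ : B.leftDual) (u : U) : B.counit (leftHit ψ u) = ψ.1 u := by
  obtain ⟨p, hp⟩ := B.exists_rep u
  rw [leftHit_eq _ hp]
  conv_rhs => rw [← B.counit_comul u p hp]
  clear hp
  induction p with
  | zero => simp
  | add p q hp hq => rw [map_add, map_add, hp, hq]; simp only [map_add]
  | tmul x y => simp [counit_target_mul, leftDual_apply]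

theorem rightHit_add (φ φ' : B.rightDual) (u : U) :
    rightHit (φ + φ') u = rightHit φ u + rightHit φ' u := by
  obtain ⟨p, hp⟩ := B.exists_rep u
  rw [rightHit_eq _ hp, rightHit_eq _ hp, rightHit_eq _ hp]
  simp [rightContract, LinearMap.comp_add, TensorProduct.map_add_left]

theorem leftHit_add (ψ ψ' : B.leftDual) (u : U) :
    leftHit (ψ + ψ') u = leftHit ψ u + leftHit ψ' u := by
  obtain ⟨p, hp⟩ := B.exists_rep u
  rw [leftHit_eq _ hp, leftHit_eq _ hp, leftHit_eq _ hp]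
  simp [leftContract, LinearMap.comp_add, TensorProduct.map_add_left]

theorem rightHit_smul (c : k) (φ : B.rightDual) (u : U) :
    rightHit (c • φ) u = c • rightHit φ u := by
  obtain ⟨p, hp⟩ := B.exists_rep u
  rw [rightHit_eq _ hp, rightHit_eq _ hp]
  simp [rightContract, LinearMap.comp_smul, TensorProduct.map_smul_left]

theorem leftHit_smul (c : k) (ψ : B.leftDual) (u : U) :
    leftHit (c • ψ) u = c • leftHit ψ u := by
  obtain ⟨p, hp⟩ := B.exists_rep u
  rw [leftHit_eq _ hp, leftHit_eq _ hp]
  simp [leftContract, LinearMap.comp_smul, TensorProduct.map_smul_left]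

theorem rightDual_ext {φ φ' : B.rightDual} (h : ∀ u, φ.1 u = φ'.1 u) : φ = φ' :=
  Subtype.ext (LinearMap.ext h)

theorem leftDual_ext {ψ ψ' : B.leftDual} (h : ∀ u, ψ.1 u = ψ'.1 u) : ψ = ψ' :=
  Subtype.ext (LinearMap.ext h)

theorem rightDual_add_mul (φ φ' χ : B.rightDual) : (φ + φ') * χ = φ * χ + φ' * χ :=
  rightDual_ext fun u => by
    change χ.1 (rightHit (φ + φ') u) = χ.1 (rightHit φ u) + χ.1 (rightHit φ' u)
    rw [rightHit_add, map_add]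

theorem leftDual_add_mul (ψ ψ' χ : B.leftDual) : (ψ + ψ') * χ = ψ * χ + ψ' * χ :=
  leftDual_ext fun u => by
    change χ.1 (leftHit (ψ + ψ') u) = χ.1 (leftHit ψ u) + χ.1 (leftHit ψ' u)
    rw [leftHit_add, map_add]

instance : Ring B.rightDual where
  __ := Submodule.addCommGroup B.rightDual
  left_distrib _ _ _ := rfl
  right_distrib := rightDual_add_mul
  zero_mul χ := by simpa using rightDual_add_mul 0 0 χ
  mul_zero _ := rfl
  mul_assoc φ φ' χ := rightDual_ext fun u => by
    rw [rightDual_mul_apply, rightHit_mul]; rfl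
  one_mul φ := rightDual_ext fun u => by rw [rightDual_mul_apply, rightHit_one]
  mul_one φ := rightDual_ext fun u => counit_rightHit φ u

instance : Ring B.leftDual where
  __ := Submodule.addCommGroup B.leftDual
  left_distrib _ _ _ := rfl
  right_distrib := leftDual_add_mul
  zero_mul χ := by simpa using leftDual_add_mul 0 0 χ
  mul_zero _ := rfl
  mul_assoc ψ ψ' χ := leftDual_ext fun u => by
    rw [leftDual_mul_apply, leftHit_mul]; rfl
  one_mul ψ := leftDual_ext fun u => by rw [leftDual_mul_apply, leftHit_one]
  mul_one ψ := leftDual_ext fun u => counit_leftHit ψ u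

instance : Algebra k B.rightDual := Algebra.ofModule
  (fun c φ χ => rightDual_ext fun u => by
    rw [rightDual_mul_apply, rightHit_smul, map_smul]; rfl)
  (fun _ _ _ => rfl)

instance : Algebra k B.leftDual := Algebra.ofModule
  (fun c ψ χ => leftDual_ext fun u => by
    rw [leftDual_mul_apply, leftHit_smul, map_smul]; rfl)
  (fun _ _ _ => rfl)

theorem rightHit_mul_source (φ : B.rightDual) (u : U) (a : A) {p : U ⊗[k] U}
    (hp : B.mk₂ p = B.comul u) :
    rightHit φ (u * B.source a) = rightContract φ (p * (B.source a ⊗ₜ[k] 1)) :=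
  rightHit_eq φ (B.comul_mul _ _ _ _ hp (B.comul_source a).symm).symm

theorem leftHit_mul_target (ψ : B.leftDual) (u : U) (a : A) {p : U ⊗[k] U}
    (hp : B.mk₂ p = B.comul u) :
    leftHit ψ (u * B.target (op a)) = leftContract ψ (p * (1 ⊗ₜ[k] B.target (op a))) :=
  leftHit_eq ψ (B.comul_mul _ _ _ _ hp (B.comul_target a).symm).symm

/-! ### The duals as right bialgebroids -/

/-- `s^*(a)(u) = ε(u s(a))` -/
def rightDualSourceLin (B : LeftBialgebroid k A U) : A →ₗ[k] B.rightDual where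
  toFun a := ⟨B.counit ∘ₗ LinearMap.mulRight k (B.source a), fun b u => by
    simp [mul_assoc, counit_target_mul]⟩
  map_add' a b := rightDual_ext fun u => by simp [mul_add]
  map_smul' c a := rightDual_ext fun u => by simp

/-- `t^*(a)(u) = a ε(u)` -/
def rightDualTargetLin (B : LeftBialgebroid k A U) : Aᵐᵒᵖ →ₗ[k] B.rightDual where
  toFun a := ⟨LinearMap.mulLeft k (unop a) ∘ₗ B.counit, fun b u => by
    simp [mul_assoc, counit_target_mul]⟩
  map_add' a b := rightDual_ext fun u => by simp [add_mul]
  map_smul' c a := rightDual_ext fun u => by simp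

/-- `s_*(a)(u) = ε(u) a` -/
def leftDualSourceLin (B : LeftBialgebroid k A U) : A →ₗ[k] B.leftDual where
  toFun a := ⟨LinearMap.mulRight k a ∘ₗ B.counit, fun b u => by
    simp [mul_assoc, counit_source_mul]⟩
  map_add' a b := leftDual_ext fun u => by simp [mul_add]
  map_smul' c a := leftDual_ext fun u => by simp

/-- `t_*(a)(u) = ε(u t(a))` -/
def leftDualTargetLin (B : LeftBialgebroid k A U) : Aᵐᵒᵖ →ₗ[k] B.leftDual where
  toFun a := ⟨B.counit ∘ₗ LinearMap.mulRight k (B.target a), fun b u => by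
    simp [mul_assoc, counit_source_mul]⟩
  map_add' a b := leftDual_ext fun u => by simp [mul_add]
  map_smul' c a := leftDual_ext fun u => by simp

theorem rightHit_source (a : A) (u : U) :
    rightHit (B.rightDualSourceLin a) u = u * B.source a := by
  obtain ⟨p, hp⟩ := B.exists_rep u
  rw [← rightHit_one (B := B) (u * B.source a), rightHit_mul_source _ _ _ hp, rightHit_eq _ hp]
  clear hp
  induction p with
  | zero => simp
  | add p q hp hq => rw [add_mul, map_add, map_add, hp, hq]
  | tmul x y =>
    rw [Algebra.TensorProduct.tmul_mul_tmul, rightContract_tmul, rightContract_tmul, mul_one]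
    rfl

theorem leftHit_target (a : A) (u : U) :
    leftHit (B.leftDualTargetLin (op a)) u = u * B.target (op a) := by
  obtain ⟨p, hp⟩ := B.exists_rep u
  rw [← leftHit_one (B := B) (u * B.target (op a)), leftHit_mul_target _ _ _ hp, leftHit_eq _ hp]
  clear hp
  induction p with
  | zero => simp
  | add p q hp hq => rw [add_mul, map_add, map_add, hp, hq]
  | tmul x y =>
    rw [Algebra.TensorProduct.tmul_mul_tmul, leftContract_tmul, leftContract_tmul, mul_one]
    rfl

theorem rightHit_target (a : A) (u : U) :
    rightHit (B.rightDualTargetLin (op a)) u = B.source a * u := by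
  obtain ⟨p, hp⟩ := B.exists_rep u
  conv_rhs => rw [← rightHit_one (B := B) u, rightHit_eq _ hp]
  rw [rightHit_eq _ hp]
  clear hp
  induction p with
  | zero => simp
  | add p q hp hq => rw [map_add, map_add, hp, hq, mul_add]
  | tmul x y =>
    rw [rightContract_tmul, rightContract_tmul, ← mul_assoc, ← map_mul]
    rfl

theorem leftHit_source (a : A) (u : U) :
    leftHit (B.leftDualSourceLin a) u = B.target (op a) * u := by
  obtain ⟨p, hp⟩ := B.exists_rep u
  conv_rhs => rw [← leftHit_one (B := B) u, leftHit_eq _ hp]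
  rw [leftHit_eq _ hp]
  clear hp
  induction p with
  | zero => simp
  | add p q hp hq => rw [map_add, map_add, hp, hq, mul_add]
  | tmul x y =>
    rw [leftContract_tmul, leftContract_tmul, ← mul_assoc, ← map_mul]
    rfl

/-- `φ ↦ φ(- v)` on the right dual -/
def rightDualTranslate (B : LeftBialgebroid k A U) (v : U) : B.rightDual →ₗ[k] B.rightDual where
  toFun φ := ⟨φ.1 ∘ₗ LinearMap.mulRight k v, fun a u => by simp [mul_assoc, rightDual_apply]⟩
  map_add' _ _ := rfl
  map_smul' _ _ := rfl

/-- `ψ ↦ ψ(- v)` on the left dual -/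
def leftDualTranslate (B : LeftBialgebroid k A U) (v : U) : B.leftDual →ₗ[k] B.leftDual where
  toFun ψ := ⟨ψ.1 ∘ₗ LinearMap.mulRight k v, fun a u => by simp [mul_assoc, leftDual_apply]⟩
  map_add' _ _ := rfl
  map_smul' _ _ := rfl

variable (B)

/-- A dual basis of `U` over `A` acting by `a ▷ u = s(a) u`. -/
structure LeftDualBasis where
  n : ℕ
  vec : Fin n → U
  coord : Fin n → B.leftDual
  sum_eq : ∀ u, ∑ i, B.source ((coord i).1 u) * vec i = u

/-- A dual basis of `U` over `A` acting by `u ◁ a = t(a) u`. -/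
structure RightDualBasis where
  n : ℕ
  vec : Fin n → U
  coord : Fin n → B.rightDual
  sum_eq : ∀ u, ∑ i, B.target (op ((coord i).1 u)) * vec i = u

variable {B}

theorem LeftFGProjective.nonempty (h : B.LeftFGProjective) : Nonempty B.LeftDualBasis := by
  let _ : Module A U := Module.compHom U (B.source : A →+* U)
  have hsmul : ∀ (a : A) (u : U), a • u = B.source a * u := fun _ _ => rfl
  obtain ⟨h1, h2⟩ : Module.Finite A U ∧ Module.Projective A U := h
  obtain ⟨n, f, g, -, -, hfg⟩ := Module.Finite.exists_comp_eq_id_of_projective A U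
  refine ⟨⟨n, fun i => f (Pi.single i 1), fun i => ⟨⟨⟨fun u => g u i, fun u v => by simp⟩,
    fun c u => ?_⟩, fun a u => ?_⟩, fun u => ?_⟩⟩
  · have : c • u = (algebraMap k A c) • u := by
      rw [hsmul, AlgHom.commutes, Algebra.smul_def]
    simp [this, Algebra.smul_def]
  · simp [← hsmul]
  · have := LinearMap.congr_fun hfg u
    conv_rhs => rw [← LinearMap.id_apply (R := A) u, ← this, LinearMap.comp_apply,
      pi_eq_sum_univ (g u), map_sum]
    refine Finset.sum_congr rfl fun i _ => ?_
    rw [map_smul, hsmul]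
    simp only [LinearMap.coe_mk, AddHom.coe_mk]
    congr 3
    ext j
    simp [Pi.single_apply, eq_comm]

theorem RightFGProjective.nonempty (h : B.RightFGProjective) : Nonempty B.RightDualBasis := by
  let _ : Module Aᵐᵒᵖ U := Module.compHom U (B.target : Aᵐᵒᵖ →+* U)
  have hsmul : ∀ (a : Aᵐᵒᵖ) (u : U), a • u = B.target a * u := fun _ _ => rfl
  obtain ⟨h1, h2⟩ : Module.Finite Aᵐᵒᵖ U ∧ Module.Projective Aᵐᵒᵖ U := h
  obtain ⟨n, f, g, -, -, hfg⟩ := Module.Finite.exists_comp_eq_id_of_projective Aᵐᵒᵖ U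
  refine ⟨⟨n, fun i => f (Pi.single i 1), fun i => ⟨⟨⟨fun u => unop (g u i), fun u v => by simp⟩,
    fun c u => ?_⟩, fun a u => ?_⟩, fun u => ?_⟩⟩
  · have : c • u = (algebraMap k Aᵐᵒᵖ c) • u := by
      rw [hsmul, AlgHom.commutes, Algebra.smul_def]
    simp only [this, map_smul, Pi.smul_apply, smul_eq_mul, MulOpposite.unop_mul,
      MulOpposite.algebraMap_apply, MulOpposite.unop_op, RingHom.id_apply]
    rw [Algebra.smul_def, Algebra.commutes]
  · simp [← hsmul]
  · have := LinearMap.congr_fun hfg u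
    conv_rhs => rw [← LinearMap.id_apply (R := Aᵐᵒᵖ) u, ← this, LinearMap.comp_apply,
      pi_eq_sum_univ (g u), map_sum]
    refine Finset.sum_congr rfl fun i _ => ?_
    rw [map_smul, hsmul]
    simp only [LinearMap.coe_mk, AddHom.coe_mk, MulOpposite.op_unop]
    congr 3
    ext j
    simp [Pi.single_apply, eq_comm]

/-- The right dual `(U^*, A, s^*, t^*, Δ^*, ∂^*)`, when `U_◁` is finitely generated projective.
Here `∂^*(φ) = φ(1)`, and `Δ^*(φ) = ∑ φ(- e_i) ⊗ e^i` for a dual basis `(e_i, e^i)`; as the theorem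
`rightDualData_comul_iff` shows, `Δ^*(φ)` is the unique element with
`φ(u v) = φ₁(u t(φ₂(v)))`, so that the choice of the dual basis does not matter. -/
def rightDualData (h : B.RightFGProjective) : RightBialgebroidData k A B.rightDual where
  source := AlgHom.ofLinearMap B.rightDualSourceLin
    (rightDual_ext fun u => by
      change B.counit (u * B.source 1) = B.counit u
      simp)
    (fun a b => rightDual_ext fun u => by
      rw [rightDual_mul_apply, rightHit_source]
      simp [rightDualSourceLin, mul_assoc])
  target := AlgHom.ofLinearMap B.rightDualTargetLin
    (rightDual_ext fun u => by
      change 1 * B.counit u = B.counit u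
      simp)
    (fun a b => rightDual_ext fun u => by
      rw [rightDual_mul_apply, ← MulOpposite.op_unop a, rightHit_target]
      simp [rightDualTargetLin, counit_source_mul])
  comul := BTensor.mk _ _ ∘ₗ ∑ i, (TensorProduct.mk k B.rightDual B.rightDual).flip
      (h.nonempty.some.coord i) ∘ₗ B.rightDualTranslate (h.nonempty.some.vec i)
  counit := LinearMap.applyₗ 1 ∘ₗ B.rightDual.subtype

/-- The left dual `(U_*, A, s_*, t_*, Δ_*, ∂_*)`, when `▷U` is finitely generated projective.
Here `∂_*(ψ) = ψ(1)`, and `Δ_*(ψ) = ∑ e^i ⊗ ψ(- e_i)` for a dual basis `(e_i, e^i)`; as the theorem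
`leftDualData_comul_iff` shows, `Δ_*(ψ)` is the unique element with
`ψ(u v) = ψ₂(u s(ψ₁(v)))`, so that the choice of the dual basis does not matter. -/
def leftDualData (h : B.LeftFGProjective) : RightBialgebroidData k A B.leftDual where
  source := AlgHom.ofLinearMap B.leftDualSourceLin
    (leftDual_ext fun u => by
      change B.counit u * 1 = B.counit u
      simp)
    (fun a b => leftDual_ext fun u => by
      rw [leftDual_mul_apply, leftHit_source]
      simp [leftDualSourceLin, counit_target_mul, mul_assoc])
  target := AlgHom.ofLinearMap B.leftDualTargetLin
    (leftDual_ext fun u => by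
      change B.counit (u * B.target 1) = B.counit u
      simp)
    (fun a b => leftDual_ext fun u => by
      rw [leftDual_mul_apply, ← MulOpposite.op_unop a, leftHit_target]
      simp [leftDualTargetLin, mul_assoc])
  comul := BTensor.mk _ _ ∘ₗ ∑ i, TensorProduct.mk k B.leftDual B.leftDual
      (h.nonempty.some.coord i) ∘ₗ B.leftDualTranslate (h.nonempty.some.vec i)
  counit := LinearMap.applyₗ 1 ∘ₗ B.leftDual.subtype

theorem counit_mul_source_eq (a : A) (u : U) :
    B.counit (u * B.source a) = B.counit (u * B.target (op a)) := by
  have := B.counit_target_mul a 1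
  rw [mul_one, B.counit_one, one_mul] at this
  rw [B.counit_mul_source u (B.target _), this]

theorem rightDual_mul_source_apply (h : B.RightFGProjective) (φ : B.rightDual) (a : A) (w : U) :
    (φ * (rightDualData h).source a).1 w = φ.1 (w * B.target (op a)) := by
  change B.counit (rightHit φ w * B.source a) = _
  obtain ⟨p, hp⟩ := B.exists_rep w
  have hq := B.comul_mul _ _ _ _ hp (B.comul_target a).symm
  rw [← counit_rightHit, rightHit_eq φ hp, rightHit_eq φ hq.symm]
  clear hp hq
  induction p with
  | zero => simp
  | add p q hp hq => rw [map_add, add_mul, map_add, add_mul, map_add, map_add, hp, hq]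
  | tmul x y =>
    simp only [rightContract_tmul, Algebra.TensorProduct.tmul_mul_tmul, mul_assoc,
      counit_source_mul, mul_one, counit_mul_source_eq]

theorem rightDual_mul_target_apply (h : B.RightFGProjective) (φ : B.rightDual) (a : A) (w : U) :
    (φ * (rightDualData h).target (op a)).1 w = a * φ.1 w := by
  change a * B.counit (rightHit φ w) = _
  rw [counit_rightHit]

theorem leftDual_mul_source_apply (h : B.LeftFGProjective) (ψ : B.leftDual) (a : A) (w : U) :
    (ψ * (leftDualData h).source a).1 w = ψ.1 w * a := by
  change B.counit (leftHit ψ w) * a = _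
  rw [counit_leftHit]

theorem leftDual_mul_target_apply (h : B.LeftFGProjective) (ψ : B.leftDual) (a : A) (w : U) :
    (ψ * (leftDualData h).target (op a)).1 w = ψ.1 (w * B.source a) := by
  change B.counit (leftHit ψ w * B.target (op a)) = _
  obtain ⟨p, hp⟩ := B.exists_rep w
  have hq := B.comul_mul _ _ _ _ hp (B.comul_source a).symm
  rw [← counit_leftHit, leftHit_eq ψ hp, leftHit_eq ψ hq.symm]
  clear hp hq
  induction p with
  | zero => simp
  | add p q hp hq => rw [map_add, add_mul, map_add, add_mul, map_add, map_add, hp, hq]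
  | tmul x y =>
    simp only [leftContract_tmul, Algebra.TensorProduct.tmul_mul_tmul, mul_assoc,
      counit_target_mul, mul_one, counit_mul_source_eq]

variable (B) in
/-- `φ ⊗ φ' ↦ φ(u t(φ'(v)))` -/
def rightEval (u v : U) : B.rightDual ⊗[k] B.rightDual →ₗ[k] A :=
  TensorProduct.lift (LinearMap.mk₂ k (fun φ φ' => φ.1 (u * B.target (op (φ'.1 v))))
    (fun _ _ _ => rfl) (fun _ _ _ => rfl) (fun _ _ _ => by simp [mul_add])
    (fun _ _ _ => by simp))

variable (B) in
/-- `ψ ⊗ ψ' ↦ ψ'(u s(ψ(v)))` -/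
def leftEval (u v : U) : B.leftDual ⊗[k] B.leftDual →ₗ[k] A :=
  TensorProduct.lift (LinearMap.mk₂ k (fun ψ ψ' => ψ'.1 (u * B.source (ψ.1 v)))
    (fun _ _ _ => by simp [mul_add]) (fun _ _ _ => by simp)
    (fun _ _ _ => rfl) (fun _ _ _ => rfl))

theorem rightEval_balanced (h : B.RightFGProjective) (u v : U) :
    balancedRel (fun a : A => LinearMap.mulRight k ((rightDualData h).source a))
      (fun a : A => LinearMap.mulRight k ((rightDualData h).target (op a))) ≤
      LinearMap.ker (B.rightEval u v) :=
  balancedRel_le_ker _ _ _ fun a φ φ' => by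
    simp only [rightEval, TensorProduct.lift.tmul, LinearMap.mulRight_apply, LinearMap.mk₂_apply,
      rightDual_mul_source_apply, rightDual_mul_target_apply]
    simp [mul_assoc]

theorem leftEval_balanced (h : B.LeftFGProjective) (u v : U) :
    balancedRel (fun a : A => LinearMap.mulRight k ((leftDualData h).source a))
      (fun a : A => LinearMap.mulRight k ((leftDualData h).target (op a))) ≤
      LinearMap.ker (B.leftEval u v) :=
  balancedRel_le_ker _ _ _ fun a φ φ' => by
    simp only [leftEval, TensorProduct.lift.tmul, LinearMap.mulRight_apply, LinearMap.mk₂_apply,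
      leftDual_mul_source_apply, leftDual_mul_target_apply]
    simp [mul_assoc]

/-- The coproduct of the right dual is characterised by `φ(u v) = φ₁(u t(φ₂(v)))`. -/
theorem rightDualData_comul_iff (h : B.RightFGProjective) (φ : B.rightDual)
    (p : B.rightDual ⊗[k] B.rightDual) :
    (rightDualData h).mk₂ p = (rightDualData h).comul φ ↔
      ∀ u v, B.rightEval u v p = φ.1 (u * v) := by
  obtain ⟨b, hb⟩ : ∃ b, b = h.nonempty.some := ⟨_, rfl⟩
  have hc : (rightDualData h).comul φ =
      (rightDualData h).mk₂ (∑ i, B.rightDualTranslate (b.vec i) φ ⊗ₜ[k] b.coord i) := by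
    rw [hb, rightDualData]
    refine congrArg (BTensor.mk _ _) ?_
    rw [LinearMap.sum_apply]
    rfl
  rw [hc]
  constructor
  · intro hp u v
    have hz : B.rightEval u v
        (p - ∑ i, B.rightDualTranslate (b.vec i) φ ⊗ₜ[k] b.coord i) = 0 :=
      rightEval_balanced h u v ((Submodule.Quotient.eq _).1 hp)
    rw [map_sub, sub_eq_zero] at hz
    rw [hz, map_sum]
    conv_rhs => rw [← b.sum_eq v, Finset.mul_sum, map_sum]
    refine Finset.sum_congr rfl fun i _ => ?_
    simp [rightEval, rightDualTranslate, mul_assoc]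
  · intro hp
    let E (i : Fin b.n) : B.rightDual ⊗[k] B.rightDual →ₗ[k] B.rightDual :=
      LinearMap.mul' k _ ∘ₗ TensorProduct.map LinearMap.id
        ((rightDualData h).source.toLinearMap ∘ₗ LinearMap.applyₗ (b.vec i) ∘ₗ B.rightDual.subtype)
    have hE : ∀ i p u, (E i p).1 u = B.rightEval u (b.vec i) p := by
      intro i p u
      induction p with
      | zero => simp
      | add p q hp hq => rw [map_add, map_add, ← hp, ← hq]; rfl
      | tmul φ φ' =>
        simp only [E, LinearMap.comp_apply, TensorProduct.map_tmul, LinearMap.mul'_apply,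
          LinearMap.id_apply, AlgHom.toLinearMap_apply, rightDual_mul_source_apply]
        simp [rightEval]
    have key : ∀ p, (rightDualData h).mk₂ p =
        (rightDualData h).mk₂ (∑ i, E i p ⊗ₜ[k] b.coord i) := by
      intro p
      induction p with
      | zero => simp
      | add p q hp hq =>
        rw [map_add, hp, hq, ← map_add, ← Finset.sum_add_distrib]
        simp [TensorProduct.add_tmul]
      | tmul φ φ' =>
        have h1 : ∀ i, (rightDualData h).mk₂ (E i (φ ⊗ₜ φ') ⊗ₜ[k] b.coord i) =
            (rightDualData h).mk₂
              (φ ⊗ₜ[k] (b.coord i * (rightDualData h).target (op (φ'.1 (b.vec i))))) := by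
          intro i
          exact BTensor.mk_balanced (k := k)
            (fun a : A => LinearMap.mulRight k ((rightDualData h).source a))
            (fun a : A => LinearMap.mulRight k ((rightDualData h).target (op a)))
            (φ'.1 (b.vec i)) φ (b.coord i)
        have h2 : φ' = ∑ i, b.coord i * (rightDualData h).target (op (φ'.1 (b.vec i))) := by
          refine rightDual_ext fun u => ?_
          conv_lhs => rw [← b.sum_eq u, map_sum]
          rw [AddSubmonoidClass.coe_finsetSum, LinearMap.sum_apply]
          refine Finset.sum_congr rfl fun i _ => ?_
          rw [rightDual_mul_target_apply, rightDual_apply]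
        rw [map_sum]
        simp_rw [h1]
        rw [← map_sum, ← TensorProduct.tmul_sum, ← h2]
    rw [key]
    congr 1
    refine Finset.sum_congr rfl fun i _ => ?_
    congr 1
    exact rightDual_ext fun u => by rw [hE, hp]; rfl

/-- The coproduct of the left dual is characterised by `ψ(u v) = ψ₂(u s(ψ₁(v)))`. -/
theorem leftDualData_comul_iff (h : B.LeftFGProjective) (ψ : B.leftDual)
    (p : B.leftDual ⊗[k] B.leftDual) :
    (leftDualData h).mk₂ p = (leftDualData h).comul ψ ↔
      ∀ u v, B.leftEval u v p = ψ.1 (u * v) := by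
  obtain ⟨b, hb⟩ : ∃ b, b = h.nonempty.some := ⟨_, rfl⟩
  have hc : (leftDualData h).comul ψ =
      (leftDualData h).mk₂ (∑ i, b.coord i ⊗ₜ[k] B.leftDualTranslate (b.vec i) ψ) := by
    rw [hb, leftDualData]
    refine congrArg (BTensor.mk _ _) ?_
    rw [LinearMap.sum_apply]
    rfl
  rw [hc]
  constructor
  · intro hp u v
    have hz : B.leftEval u v
        (p - ∑ i, b.coord i ⊗ₜ[k] B.leftDualTranslate (b.vec i) ψ) = 0 :=
      leftEval_balanced h u v ((Submodule.Quotient.eq _).1 hp)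
    rw [map_sub, sub_eq_zero] at hz
    rw [hz, map_sum]
    conv_rhs => rw [← b.sum_eq v, Finset.mul_sum, map_sum]
    refine Finset.sum_congr rfl fun i _ => ?_
    simp [leftEval, leftDualTranslate, mul_assoc]
  · intro hp
    let E (i : Fin b.n) : B.leftDual ⊗[k] B.leftDual →ₗ[k] B.leftDual :=
      LinearMap.mul' k _ ∘ₗ TensorProduct.map LinearMap.id
        ((leftDualData h).target.toLinearMap ∘ₗ (MulOpposite.opLinearEquiv k).toLinearMap ∘ₗ
          LinearMap.applyₗ (b.vec i) ∘ₗ B.leftDual.subtype) ∘ₗ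
        (TensorProduct.comm k _ _).toLinearMap
    have hE : ∀ i p u, (E i p).1 u = B.leftEval u (b.vec i) p := by
      intro i p u
      induction p with
      | zero => simp
      | add p q hp hq => rw [map_add, map_add, ← hp, ← hq]; rfl
      | tmul ψ ψ' =>
        simp only [E, LinearMap.comp_apply, TensorProduct.map_tmul, LinearMap.mul'_apply,
          LinearMap.id_apply, AlgHom.toLinearMap_apply, LinearEquiv.coe_coe,
          TensorProduct.comm_tmul, MulOpposite.coe_opLinearEquiv, leftDual_mul_target_apply]
        simp [leftEval]
    have key : ∀ p, (leftDualData h).mk₂ p =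
        (leftDualData h).mk₂ (∑ i, b.coord i ⊗ₜ[k] E i p) := by
      intro p
      induction p with
      | zero => simp
      | add p q hp hq =>
        rw [map_add, hp, hq, ← map_add, ← Finset.sum_add_distrib]
        simp [TensorProduct.tmul_add]
      | tmul ψ ψ' =>
        have h1 : ∀ i, (leftDualData h).mk₂ (b.coord i ⊗ₜ[k] E i (ψ ⊗ₜ ψ')) =
            (leftDualData h).mk₂
              ((b.coord i * (leftDualData h).source (ψ.1 (b.vec i))) ⊗ₜ[k] ψ') := by
          intro i
          exact (BTensor.mk_balanced (k := k)
            (fun a : A => LinearMap.mulRight k ((leftDualData h).source a))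
            (fun a : A => LinearMap.mulRight k ((leftDualData h).target (op a)))
            (ψ.1 (b.vec i)) (b.coord i) ψ').symm
        have h2 : ψ = ∑ i, b.coord i * (leftDualData h).source (ψ.1 (b.vec i)) := by
          refine leftDual_ext fun u => ?_
          conv_lhs => rw [← b.sum_eq u, map_sum]
          rw [AddSubmonoidClass.coe_finsetSum, LinearMap.sum_apply]
          refine Finset.sum_congr rfl fun i _ => ?_
          rw [leftDual_mul_source_apply, leftDual_apply]
        rw [map_sum]
        simp_rw [h1]
        rw [← map_sum, ← TensorProduct.sum_tmul, ← h2]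
    rw [key]
    congr 1
    refine Finset.sum_congr rfl fun i _ => ?_
    congr 1
    exact leftDual_ext fun u => by rw [hE, hp]; rfl

/-! ### The maps between the duals -/

/-- `x ⊗ y ↦ ε(x t(φ(y)))` -/
def upperContract (φ : B.rightDual) : B.HopfSource →ₗ[k] A :=
  Submodule.liftQ _ (B.counit ∘ₗ LinearMap.mul' k U ∘ₗ TensorProduct.map LinearMap.id
      (B.target.toLinearMap ∘ₗ (MulOpposite.opLinearEquiv k).toLinearMap ∘ₗ φ.1))
    (balancedRel_le_ker _ _ _ fun a x y => by simp [rightDual_apply, mul_assoc])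

/-- `x ⊗ y ↦ ε(x s(ψ(y)))` -/
def lowerContract (ψ : B.leftDual) : B.HopfSource' →ₗ[k] A :=
  Submodule.liftQ _ (B.counit ∘ₗ LinearMap.mul' k U ∘ₗ TensorProduct.map LinearMap.id
      (B.source.toLinearMap ∘ₗ ψ.1))
    (balancedRel_le_ker _ _ _ fun a x y => by simp [leftDual_apply, mul_assoc])

theorem upperContract_mk (φ : B.rightDual) (p : U ⊗[k] U) :
    upperContract φ (BTensor.mk _ _ p) = B.counit (LinearMap.mul' k U (TensorProduct.map
      LinearMap.id (B.target.toLinearMap ∘ₗ (MulOpposite.opLinearEquiv k).toLinearMap ∘ₗ φ.1) p)) :=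
  rfl

theorem lowerContract_mk (ψ : B.leftDual) (p : U ⊗[k] U) :
    lowerContract ψ (BTensor.mk _ _ p) = B.counit (LinearMap.mul' k U (TensorProduct.map
      LinearMap.id (B.source.toLinearMap ∘ₗ ψ.1) p)) :=
  rfl

theorem galoisLeft_mk (x y : U) :
    B.galoisLeft (BTensor.mk _ _ (x ⊗ₜ y)) = B.rightAct (B.comul x) (1 ⊗ₜ y) := rfl

theorem galoisRight_mk (x y : U) :
    B.galoisRight (BTensor.mk _ _ (x ⊗ₜ y)) = B.rightAct (B.comul x) (y ⊗ₜ 1) := rfl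

theorem galoisLeft_source_mul (a : A) (p q : U ⊗[k] U)
    (h : B.galoisLeft (BTensor.mk _ _ p) = B.mk₂ q) :
    B.galoisLeft (BTensor.mk _ _ ((B.source a ⊗ₜ[k] 1) * p)) =
      B.mk₂ ((B.source a ⊗ₜ[k] 1) * q) := by
  let L : BTensor (fun a : A => LinearMap.mulLeft k (B.target (op a)))
      (fun a : A => LinearMap.mulLeft k (B.source a)) →ₗ[k] _ :=
    Submodule.liftQ _ (B.mk₂ ∘ₗ LinearMap.mulLeft k (B.source a ⊗ₜ[k] (1 : U)))
      (balancedRel_le_ker _ _ _ fun c x y => by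
        simp only [LinearMap.comp_apply, LinearMap.mulLeft_apply,
          Algebra.TensorProduct.tmul_mul_tmul, one_mul]
        rw [← mul_assoc, B.source_mul_target, mul_assoc]
        exact BTensor.mk_balanced (k := k) (fun a : A => LinearMap.mulLeft k (B.target (op a)))
          (fun a : A => LinearMap.mulLeft k (B.source a)) c _ _)
  have key : ∀ p, B.galoisLeft (BTensor.mk _ _ ((B.source a ⊗ₜ[k] 1) * p)) =
      L (B.galoisLeft (BTensor.mk _ _ p)) := by
    intro p
    induction p with
    | zero => simp
    | add p q hp hq => rw [mul_add, map_add, map_add, map_add, map_add, map_add, hp, hq]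
    | tmul x y =>
      obtain ⟨q, hq⟩ := B.exists_rep x
      have h1 := B.comul_bimodule a 1 x q hq
      simp only [MulOpposite.op_one, map_one, mul_one] at h1
      rw [Algebra.TensorProduct.tmul_mul_tmul, one_mul, galoisLeft_mk, galoisLeft_mk, h1, ← hq,
        rightAct_mk, rightAct_mk, mul_assoc]
      rfl
  rw [key, h]
  rfl

theorem galoisRight_target_mul (a : A) (p q : U ⊗[k] U)
    (h : B.galoisRight (BTensor.mk _ _ p) = B.mk₂ q) :
    B.galoisRight (BTensor.mk _ _ ((B.target (op a) ⊗ₜ[k] 1) * p)) =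
      B.mk₂ ((1 ⊗ₜ[k] B.target (op a)) * q) := by
  let L : BTensor (fun a : A => LinearMap.mulLeft k (B.target (op a)))
      (fun a : A => LinearMap.mulLeft k (B.source a)) →ₗ[k] _ :=
    Submodule.liftQ _ (B.mk₂ ∘ₗ LinearMap.mulLeft k ((1 : U) ⊗ₜ[k] B.target (op a)))
      (balancedRel_le_ker _ _ _ fun c x y => by
        simp only [LinearMap.comp_apply, LinearMap.mulLeft_apply,
          Algebra.TensorProduct.tmul_mul_tmul, one_mul]
        rw [← mul_assoc (B.target _) (B.source c) y, ← B.source_mul_target, mul_assoc]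
        exact BTensor.mk_balanced (k := k) (fun a : A => LinearMap.mulLeft k (B.target (op a)))
          (fun a : A => LinearMap.mulLeft k (B.source a)) c _ _)
  have key : ∀ p, B.galoisRight (BTensor.mk _ _ ((B.target (op a) ⊗ₜ[k] 1) * p)) =
      L (B.galoisRight (BTensor.mk _ _ p)) := by
    intro p
    induction p with
    | zero => simp
    | add p q hp hq => rw [mul_add, map_add, map_add, map_add, map_add, map_add, hp, hq]
    | tmul x y =>
      obtain ⟨q, hq⟩ := B.exists_rep x
      have h1 := B.comul_bimodule 1 a x q hq
      simp only [map_one, one_mul] at h1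
      rw [Algebra.TensorProduct.tmul_mul_tmul, one_mul, galoisRight_mk, galoisRight_mk, h1, ← hq,
        rightAct_mk, rightAct_mk, mul_assoc]
      rfl
  rw [key, h]
  rfl

theorem IsLeftHopf.translation_spec (h : B.IsLeftHopf) (u : U) :
    B.galoisLeft (h.translation u) = B.mk₂ (u ⊗ₜ 1) :=
  LinearEquiv.apply_symm_apply (LinearEquiv.ofBijective B.galoisLeft h) _

theorem IsRightHopf.translation_spec (h : B.IsRightHopf) (u : U) :
    B.galoisRight (h.translation u) = B.mk₂ (1 ⊗ₜ u) :=
  LinearEquiv.apply_symm_apply (LinearEquiv.ofBijective B.galoisRight h) _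

/-- `S^* : U^* → U_*`, `S^*(φ)(u) = ε(u₊ t(φ(u₋)))`, for a left Hopf algebroid. -/
def upperS (h : B.IsLeftHopf) (φ : B.rightDual) : B.leftDual :=
  ⟨upperContract φ ∘ₗ h.translation, fun a u => by
    obtain ⟨p, hp⟩ := Submodule.mkQ_surjective _ (h.translation u)
    have h1 : h.translation (B.source a * u) = BTensor.mk _ _ ((B.source a ⊗ₜ[k] 1) * p) := by
      apply h.1
      rw [h.translation_spec, galoisLeft_source_mul a p _
        ((congrArg _ hp).trans (h.translation_spec u))]
      simp
    rw [LinearMap.comp_apply, LinearMap.comp_apply, h1, ← hp]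
    change upperContract φ (BTensor.mk _ _ _) = a * upperContract φ (BTensor.mk _ _ _)
    rw [upperContract_mk, upperContract_mk]
    clear h1 hp
    induction p with
    | zero => simp
    | add p q hp hq =>
      rw [mul_add, map_add, map_add, map_add, hp, hq]; simp only [map_add, mul_add]
    | tmul x y => simp [mul_assoc, counit_source_mul]⟩

/-- `S_* : U_* → U^*`, `S_*(ψ)(u) = ε(u₍₊₎ s(ψ(u₍₋₎)))`, for a right Hopf algebroid. -/
def lowerS (h : B.IsRightHopf) (ψ : B.leftDual) : B.rightDual :=
  ⟨lowerContract ψ ∘ₗ h.translation, fun a u => by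
    obtain ⟨p, hp⟩ := Submodule.mkQ_surjective _ (h.translation u)
    have h1 : h.translation (B.target (op a) * u) =
        BTensor.mk _ _ ((B.target (op a) ⊗ₜ[k] 1) * p) := by
      apply h.1
      rw [h.translation_spec, galoisRight_target_mul a p _
        ((congrArg _ hp).trans (h.translation_spec u))]
      simp
    rw [LinearMap.comp_apply, LinearMap.comp_apply, h1, ← hp]
    change lowerContract ψ (BTensor.mk _ _ _) = lowerContract ψ (BTensor.mk _ _ _) * a
    rw [lowerContract_mk, lowerContract_mk]
    clear h1 hp
    induction p with
    | zero => simp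
    | add p q hp hq =>
      rw [mul_add, map_add, map_add, map_add, hp, hq]; simp only [map_add, add_mul]
    | tmul x y => simp [mul_assoc, counit_target_mul]⟩

end LeftBialgebroid

end Bgd

end

noncomputable section

namespace Bgd

namespace LeftBialgebroid

variable {k : Type*} [CommRing k] {A : Type*} [Ring A] [Algebra k A]
  {U : Type*} [Ring U] [Algebra k U] {B : LeftBialgebroid k A U}

/-! Cocommutativity makes the two sides of the bialgebroid indistinguishable. As s = t, the maps α_ℓ
and α_r have the same source, and u₁v ⊗ u₂ = u₂v ⊗ u₁ is the flip of u₁ ⊗ u₂v. Hence α_r = flip ∘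
α_ℓ (`galoisRight_eq_flip`): one is bijective exactly when the other is, and the two translation
maps have common representatives. The same symmetry turns both dual products into the convolution
φ(u₁)φ'(u₂), which is commutative.

The bialgebroid axioms of the dual are tested against U. The coproduct Δφ is the only element with
φ₁(u s(φ₂(v))) = φ(uv), and a dual basis shows that an element of a threefold tensor product is
determined by its values on triples. Coassociativity in U^* is then associativity in U, and
multiplicativity of its coproduct is multiplicativity of that of U. This is done for an abstract
`DualPairing`. All four coassociativities needed (left, right and two mixed ones) are instances of
`comulLeft_eq_comulRight`. The bialgebroid U_* is obtained from U^* by reversing the tensor factors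
(`RightBialgebroid.ofFlip`).

Bijectivity of α_ℓ enters only with the antipode S(φ)(u) = ε(u₊ t(φ(u₋))), whose properties reflect
identities of the translation map: u₊u₋₊ ⊗ u₋₋ = 1 ⊗ u gives S² = id; u₁₊ ⊗ u₁₋u₂ = u ⊗ 1 gives
S(φ₁)φ₂ = s^*(φ(1)); and u₊u₋ = s(ε(u)), with a contracted form of u₁ ⊗ u₂₊ ⊗ u₂₋ = u₊₁ ⊗ u₊₂ ⊗ u₋,
gives φ₁S(φ₂) = t^*(φ(1)). -/

theorem mk₂_balanced (B : LeftBialgebroid k A U) (a : A) (x y : U) :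
    B.mk₂ ((B.target (op a) * x) ⊗ₜ[k] y) = B.mk₂ (x ⊗ₜ[k] (B.source a * y)) :=
  BTensor.mk_balanced (k := k) (fun a : A => LinearMap.mulLeft k (B.target (op a)))
    (fun a : A => LinearMap.mulLeft k (B.source a)) a x y

/-! ### The flip of `U ⊗_A U`, and the equality of the two duals as rings. -/

namespace IsCocommutative

/-- The flip of `U ⊗_A U`. -/
def flip (hB : B.IsCocommutative) :
    BTensor (fun a : A => LinearMap.mulLeft k (B.target (op a)))
      (fun a : A => LinearMap.mulLeft k (B.source a)) →ₗ[k]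
    BTensor (fun a : A => LinearMap.mulLeft k (B.target (op a)))
      (fun a : A => LinearMap.mulLeft k (B.source a)) :=
  Submodule.liftQ _ (B.mk₂ ∘ₗ (TensorProduct.comm k U U).toLinearMap)
    (balancedRel_le_ker _ _ _ fun a x y => by
      have h := B.mk₂_balanced a y x
      simp only [hB.source_eq_target] at h
      simpa [hB.source_eq_target] using h.symm)

theorem flip_mk (hB : B.IsCocommutative) (p : U ⊗[k] U) :
    hB.flip (B.mk₂ p) = B.mk₂ (TensorProduct.comm k U U p) := rfl

theorem flip_flip (hB : B.IsCocommutative) : Function.Involutive hB.flip := by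
  intro z
  obtain ⟨p, rfl⟩ := Submodule.mkQ_surjective _ z
  exact congrArg B.mk₂ (by simp)

/-- For cocommutative bialgebroids the sources of the two Hopf-Galois maps coincide. -/
def hopfSourceEquiv (hB : B.IsCocommutative) : B.HopfSource ≃ₗ[k] B.HopfSource' :=
  Submodule.quotEquivOfEq _ _ (by simp only [hB.source_eq_target])

theorem galoisRight_eq_flip (hB : B.IsCocommutative) (z : B.HopfSource) :
    B.galoisRight (hB.hopfSourceEquiv z) = hB.flip (B.galoisLeft z) := by
  obtain ⟨p, rfl⟩ := Submodule.mkQ_surjective _ z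
  change B.galoisRight (BTensor.mk _ _ p) = hB.flip (B.galoisLeft (BTensor.mk _ _ p))
  induction p with
  | zero => simp
  | add p q hp hq => simp only [map_add, hp, hq]
  | tmul x y =>
    obtain ⟨q, hq⟩ := B.exists_rep x
    rw [galoisRight_mk, galoisLeft_mk, ← hq]
    change _ = hB.flip (B.mk₂ (q * (1 ⊗ₜ[k] y)))
    rw [flip_mk]
    -- Cocommutativity is used here: on the α_r side `q` is traded for its flip, while the α_ℓ side
    -- keeps `q`.
    rw [← hB.comul_comm x q hq] at hq
    rw [hq, rightAct_mk]
    congr 1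
    clear hq
    induction q with
    | zero => simp
    | add p q hp hq => simp only [map_add, add_mul, hp, hq]
    | tmul a b => simp

theorem isLeftHopf_iff_isRightHopf (hB : B.IsCocommutative) : B.IsLeftHopf ↔ B.IsRightHopf := by
  have h : B.galoisRight ∘ hB.hopfSourceEquiv = hB.flip ∘ B.galoisLeft :=
    funext hB.galoisRight_eq_flip
  rw [IsRightHopf, ← Function.Bijective.of_comp_iff _ hB.hopfSourceEquiv.bijective, h,
    Function.Bijective.of_comp_iff' hB.flip_flip.bijective]
  rfl

theorem rightDual_source_mul (hB : B.IsCocommutative) (φ : B.rightDual) (a : A) (u : U) :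
    φ.1 (B.source a * u) = a * φ.1 u := by
  rw [hB.source_eq_target, rightDual_apply, hB.base_comm]

/-- `(φ φ')(u) = φ(u₁) φ'(u₂)` -/
theorem rightDual_mul_apply (hB : B.IsCocommutative) (φ φ' : B.rightDual) {u : U} {p : U ⊗[k] U}
    (hp : B.mk₂ p = B.comul u) :
    (φ * φ').1 u = LinearMap.mul' k A (TensorProduct.map φ.1 φ'.1 p) := by
  rw [LeftBialgebroid.rightDual_mul_apply, rightHit_eq φ hp]
  clear hp
  induction p with
  | zero => simp
  | add p q hp hq => simp only [map_add, hp, hq]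
  | tmul x y => simp [hB.rightDual_source_mul]

theorem leftDual_mul_apply (hB : B.IsCocommutative) (ψ ψ' : B.leftDual) {u : U} {p : U ⊗[k] U}
    (hp : B.mk₂ p = B.comul u) :
    (ψ * ψ').1 u = LinearMap.mul' k A (TensorProduct.map ψ'.1 ψ.1 p) := by
  rw [LeftBialgebroid.leftDual_mul_apply, leftHit_eq ψ hp]
  clear hp
  induction p with
  | zero => simp
  | add p q hp hq => simp only [map_add, hp, hq]
  | tmul x y => simp [← hB.source_eq_target, leftDual_apply, hB.base_comm (ψ.1 y)]

/-- Convolution with values in a commutative ring is symmetric once Δu may be computed from the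
flipped representative. -/
theorem rightDual_mul_comm (hB : B.IsCocommutative) (φ φ' : B.rightDual) : φ * φ' = φ' * φ :=
  rightDual_ext fun u => by
    obtain ⟨p, hp⟩ := B.exists_rep u
    rw [hB.rightDual_mul_apply φ φ' hp, hB.rightDual_mul_apply φ' φ (hB.comul_comm u p hp)]
    clear hp
    induction p with
    | zero => simp
    | add p q hp hq => simp only [map_add, hp, hq]
    | tmul x y => simp [hB.base_comm (φ.1 x)]

theorem leftDual_mul_comm (hB : B.IsCocommutative) (φ φ' : B.leftDual) : φ * φ' = φ' * φ :=
  leftDual_ext fun u => by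
    obtain ⟨p, hp⟩ := B.exists_rep u
    rw [hB.leftDual_mul_apply φ φ' hp, hB.leftDual_mul_apply φ' φ (hB.comul_comm u p hp)]
    clear hp
    induction p with
    | zero => simp
    | add p q hp hq => simp only [map_add, hp, hq]
    | tmul x y => simp [hB.base_comm (φ.1 y)]

/-- The identification of `U^*` and `U_*` as modules. -/
def dualLinearEquiv (hB : B.IsCocommutative) : B.rightDual ≃ₗ[k] B.leftDual where
  toFun φ := ⟨φ.1, hB.rightDual_source_mul φ⟩
  invFun ψ := ⟨ψ.1, fun a u => by
    rw [← hB.source_eq_target, leftDual_apply, hB.base_comm]⟩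
  map_add' _ _ := rfl
  map_smul' _ _ := rfl
  left_inv _ := rfl
  right_inv _ := rfl

/-- The convolution formula of `U_*` has its legs in the opposite order, so commutativity of `U_*`
is spent to match the two. -/
theorem dualLinearEquiv_mul (hB : B.IsCocommutative) (φ φ' : B.rightDual) :
    hB.dualLinearEquiv (φ * φ') = hB.dualLinearEquiv φ * hB.dualLinearEquiv φ' :=
  leftDual_ext fun u => by
    obtain ⟨p, hp⟩ := B.exists_rep u
    rw [hB.leftDual_mul_comm, hB.leftDual_mul_apply _ _ hp]
    exact hB.rightDual_mul_apply φ φ' hp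

/-- The identification `U^* = U_*` for a cocommutative left bialgebroid. -/
def dualEquiv (hB : B.IsCocommutative) : B.rightDual ≃ₐ[k] B.leftDual :=
  AlgEquiv.ofLinearEquiv hB.dualLinearEquiv rfl hB.dualLinearEquiv_mul

/-- This is the source of the coopposite: as s = t, the conditions characterising the two coproducts
differ only by the order of the tensor factors. -/
theorem rightEval_dualEquiv (hB : B.IsCocommutative) (u v : U) (p : B.leftDual ⊗[k] B.leftDual) :
    B.rightEval u v (TensorProduct.map hB.dualEquiv.symm.toLinearMap
      hB.dualEquiv.symm.toLinearMap (TensorProduct.comm k _ _ p)) = B.leftEval u v p := by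
  induction p with
  | zero => rw [map_zero, map_zero, map_zero, map_zero]
  | add p q hp hq => rw [map_add, map_add, map_add, map_add, hp, hq]
  | tmul x y =>
    change y.1 (u * B.target (op (x.1 v))) = y.1 (u * B.source (x.1 v))
    rw [hB.source_eq_target]

end IsCocommutative

end LeftBialgebroid

/-! ### Right bialgebroids from a perfect pairing with a cocommutative left bialgebroid. -/

section DualPairing

variable {k : Type*} [CommRing k] {A : Type*} [Ring A] [Algebra k A]
  {U : Type*} [Ring U] [Algebra k U] (B : LeftBialgebroid k A U)
  {R : Type*} [Ring R] [Algebra k R]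

/-- `x ⊗ y ↦ ⟨x, u s(⟨y, v⟩)⟩` for a pairing of `R` with `U`. -/
def pairEval (ev : R →ₗ[k] U →ₗ[k] A) (u v : U) : R ⊗[k] R →ₗ[k] A :=
  TensorProduct.lift (LinearMap.mk₂ k (fun x y => ev x (u * B.source (ev y v)))
    (by simp) (by simp) (by simp [mul_add]) (by simp))

@[simp] theorem pairEval_tmul (ev : R →ₗ[k] U →ₗ[k] A) (u v : U) (x y : R) :
    pairEval B ev u v (x ⊗ₜ y) = ev x (u * B.source (ev y v)) := rfl

/-- `x ⊗ y ⊗ z ↦ ⟨x, u s(⟨y, v s(⟨z, w⟩)⟩)⟩` for a pairing of `R` with `U`. -/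
def pairEval₃ (ev : R →ₗ[k] U →ₗ[k] A) (u v w : U) : R ⊗[k] (R ⊗[k] R) →ₗ[k] A :=
  TensorProduct.lift (LinearMap.mk₂ k (fun x q => ev x (u * B.source (pairEval B ev v w q)))
    (by simp) (by simp) (by simp [mul_add]) (by simp))

@[simp] theorem pairEval₃_tmul (ev : R →ₗ[k] U →ₗ[k] A) (u v w : U) (x : R) (q : R ⊗[k] R) :
    pairEval₃ B ev u v w (x ⊗ₜ q) = ev x (u * B.source (pairEval B ev v w q)) := rfl

theorem pairEval₃_assoc (ev : R →ₗ[k] U →ₗ[k] A) (u v w : U) (q : R ⊗[k] R) (z : R) :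
    pairEval₃ B ev u v w (TensorProduct.assoc k R R R (q ⊗ₜ z)) =
      pairEval B ev u (v * B.source (ev z w)) q := by
  induction q with
  | zero => simp
  | add p q hp hq => simp only [TensorProduct.add_tmul, map_add, hp, hq]
  | tmul x y => simp

/-- A perfect pairing between a right bialgebroid and a left bialgebroid (whose source and
target coincide) which is finitely generated projective over the base. -/
structure DualPairing (D : RightBialgebroidData k A R) where
  base_comm : ∀ a b : A, a * b = b * a
  ev : R →ₗ[k] U →ₗ[k] A
  ev_ext : ∀ x y, (∀ u, ev x u = ev y u) → x = y
  ev_mul : ∀ x y u p, B.mk₂ p = B.comul u →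
    ev (x * y) u = LinearMap.mul' k A (TensorProduct.map (ev x) (ev y) p)
  ev_one : ∀ u, ev 1 u = B.counit u
  ev_source_mul : ∀ x a u, ev x (B.source a * u) = a * ev x u
  ev_mul_source : ∀ x a u, ev (x * D.source a) u = ev x (u * B.source a)
  ev_mul_target : ∀ x a u, ev (x * D.target (op a)) u = a * ev x u
  counit_eq : ∀ x, D.counit x = ev x 1
  comul_iff : ∀ x p, D.mk₂ p = D.comul x ↔ ∀ u v, pairEval B ev u v p = ev x (u * v)
  n : ℕ
  vec : Fin n → U
  coord : Fin n → R
  sum_eq : ∀ u, ∑ i, B.source (ev (coord i) u) * vec i = u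

namespace DualPairing

variable {B} {D : RightBialgebroidData k A R} (P : DualPairing B D)
include P

/-- The coordinates generate `R` over the target. Pairing with u, this is the dual basis expansion
of u to which x is applied. -/
theorem eq_sum (x : R) : x = ∑ i, P.coord i * D.target (op (P.ev x (P.vec i))) := by
  refine P.ev_ext _ _ fun u => ?_
  conv_lhs => rw [← P.sum_eq u, map_sum]
  rw [map_sum, LinearMap.sum_apply]
  refine Finset.sum_congr rfl fun i _ => ?_
  rw [P.ev_mul_target, P.ev_source_mul, P.base_comm]

section Triple

variable {f g f' g' : A → R →ₗ[k] R}

theorem mk₃_eq_sum (hf : ∀ a x, f a x = x * D.source a) (hg : ∀ a x, g a x = x * D.target (op a))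
    (hf' : ∀ a x, f' a x = x * D.source a) (hg' : ∀ a x, g' a x = x * D.target (op a))
    (x y z : R) :
    (balancedRel₃ f g f' g').mkQ (x ⊗ₜ (y ⊗ₜ z)) = ∑ i, ∑ j, (balancedRel₃ f g f' g').mkQ
      ((x * D.source (pairEval B P.ev (P.vec j) (P.vec i) (y ⊗ₜ z))) ⊗ₜ
        (P.coord j ⊗ₜ P.coord i)) := by
  have h1 : ∀ a x y z, (balancedRel₃ f g f' g').mkQ ((x * D.source a) ⊗ₜ (y ⊗ₜ z)) =
      (balancedRel₃ f g f' g').mkQ (x ⊗ₜ ((y * D.target (op a)) ⊗ₜ z)) := fun a x y z => by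
    rw [← sub_eq_zero, ← map_sub, Submodule.mkQ_apply, Submodule.Quotient.mk_eq_zero, ← hf, ← hg]
    exact Submodule.subset_span (Or.inl ⟨a, x, y, z, rfl⟩)
  have h2 : ∀ a x y z, (balancedRel₃ f g f' g').mkQ (x ⊗ₜ ((y * D.source a) ⊗ₜ z)) =
      (balancedRel₃ f g f' g').mkQ (x ⊗ₜ (y ⊗ₜ (z * D.target (op a)))) := fun a x y z => by
    rw [← sub_eq_zero, ← map_sub, Submodule.mkQ_apply, Submodule.Quotient.mk_eq_zero, ← hf', ← hg']
    exact Submodule.subset_span (Or.inr ⟨a, x, y, z, rfl⟩)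
  -- Normal form: the target coefficient of `z` crosses to `y` as a source element; the result is
  -- expanded in turn and its coefficient crosses to `x`. Only the first leg then depends on the
  -- data.
  conv_lhs => rw [P.eq_sum z, TensorProduct.tmul_sum, TensorProduct.tmul_sum, map_sum]
  refine Finset.sum_congr rfl fun i _ => ?_
  rw [← h2]
  conv_lhs => rw [P.eq_sum (y * _), TensorProduct.sum_tmul, TensorProduct.tmul_sum, map_sum]
  refine Finset.sum_congr rfl fun j _ => ?_
  rw [← h1, P.ev_mul_source, pairEval_tmul]

/-- Nondegeneracy of the threefold pairing: in the normal form, the first legs are recovered from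
the values on the basis vectors, and equality in `R` can be tested on `U`. -/
theorem mk₃_eq_of_pairEval₃_eq (hf : ∀ a x, f a x = x * D.source a)
    (hg : ∀ a x, g a x = x * D.target (op a)) (hf' : ∀ a x, f' a x = x * D.source a)
    (hg' : ∀ a x, g' a x = x * D.target (op a)) (w w' : R ⊗[k] (R ⊗[k] R))
    (h : ∀ u v z, pairEval₃ B P.ev u v z w = pairEval₃ B P.ev u v z w') :
    (balancedRel₃ f g f' g').mkQ w = (balancedRel₃ f g f' g').mkQ w' := by
  -- `G i j w` is the first leg of `w` in front of `coord j ⊗ coord i`.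
  let G (i j : Fin P.n) : R ⊗[k] (R ⊗[k] R) →ₗ[k] R :=
    LinearMap.mul' k R ∘ₗ TensorProduct.map LinearMap.id
      (D.source.toLinearMap ∘ₗ pairEval B P.ev (P.vec j) (P.vec i))
  have hG : ∀ i j w u, P.ev (G i j w) u = pairEval₃ B P.ev u (P.vec j) (P.vec i) w := by
    intro i j w u
    induction w with
    | zero => simp
    | add p q hp hq => simp only [map_add, LinearMap.add_apply, hp, hq]
    | tmul x q => simp [G, P.ev_mul_source]
  have key : ∀ w, (balancedRel₃ f g f' g').mkQ w = ∑ i, ∑ j, (balancedRel₃ f g f' g').mkQ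
      (G i j w ⊗ₜ (P.coord j ⊗ₜ P.coord i)) := by
    intro w
    induction w with
    | zero => simp
    | add p q hp hq =>
      simp only [map_add, TensorProduct.add_tmul, Finset.sum_add_distrib] at hp hq ⊢
      rw [← hp, ← hq]
    | tmul x q =>
      induction q with
      | zero => simp
      | add p q hp hq =>
        simp only [map_add, TensorProduct.tmul_add, TensorProduct.add_tmul,
          Finset.sum_add_distrib] at hp hq ⊢
        rw [← hp, ← hq]
      | tmul y z => exact P.mk₃_eq_sum hf hg hf' hg' x y z
  have hGw : ∀ i j, G i j w = G i j w' := fun i j => P.ev_ext _ _ fun u => by rw [hG, hG, h]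
  rw [key, key w']
  simp only [hGw]

/-- Both sides pair with (u, v, z) to x(uvz). The actions are fixed only pointwise and the
coproducts only through their representatives, because the left and the right structure on a
commutative `R` use left and right multiplications, which are equal but not definitionally so. -/
theorem comulLeft_eq_comulRight (hf : ∀ a x, f a x = x * D.source a)
    (hg : ∀ a x, g a x = x * D.target (op a)) (hf' : ∀ a x, f' a x = x * D.source a)
    (hg' : ∀ a x, g' a x = x * D.target (op a)) (Δ : R →ₗ[k] BTensor f g)
    (Δ' : R →ₗ[k] BTensor f' g') (hΔ : ∀ x p, BTensor.mk f g p = Δ x → D.mk₂ p = D.comul x)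
    (hΔ' : ∀ x p, BTensor.mk f' g' p = Δ' x → D.mk₂ p = D.comul x) {x : R} {p q : R ⊗[k] R}
    (hp : D.mk₂ p = D.comul x) (hq : D.mk₂ q = D.comul x) :
    comulLeft Δ f' g' p = comulRight f g Δ' q := by
  -- The pairing is evaluated on representatives in `R ⊗[k] (R ⊗[k] R)`, so it never has to be
  -- descended to the threefold quotient.
  have hL : ∀ p, ∃ w, (balancedRel₃ f g f' g').mkQ w = comulLeft Δ f' g' p ∧
      ∀ u v z, pairEval₃ B P.ev u v z w = pairEval B P.ev (u * v) z p := by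
    intro p
    induction p with
    | zero => exact ⟨0, by simp, by simp⟩
    | add p q hp hq =>
      obtain ⟨w, hw, hw'⟩ := hp
      obtain ⟨t, ht, ht'⟩ := hq
      exact ⟨w + t, by rw [map_add, map_add, hw, ht], fun u v z => by
        rw [map_add, map_add, hw', ht']⟩
    | tmul x y =>
      obtain ⟨r, hr⟩ := Submodule.mkQ_surjective _ (Δ x)
      refine ⟨TensorProduct.assoc k R R R (r ⊗ₜ y), ?_, fun u v z => ?_⟩
      · rw [comulLeft, TensorProduct.lift.tmul, LinearMap.comp_apply, ← hr]
        rfl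
      · rw [pairEval₃_assoc, (P.comul_iff x r).1 (hΔ x r hr), pairEval_tmul, mul_assoc]
  have hR : ∀ p, ∃ w, (balancedRel₃ f g f' g').mkQ w = comulRight f g Δ' p ∧
      ∀ u v z, pairEval₃ B P.ev u v z w = pairEval B P.ev u (v * z) p := by
    intro p
    induction p with
    | zero => exact ⟨0, by simp, by simp⟩
    | add p q hp hq =>
      obtain ⟨w, hw, hw'⟩ := hp
      obtain ⟨t, ht, ht'⟩ := hq
      exact ⟨w + t, by rw [map_add, map_add, hw, ht], fun u v z => by
        rw [map_add, map_add, hw', ht']⟩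
    | tmul x y =>
      obtain ⟨r, hr⟩ := Submodule.mkQ_surjective _ (Δ' y)
      refine ⟨x ⊗ₜ r, ?_, fun u v z => ?_⟩
      · rw [comulRight, TensorProduct.lift.tmul, LinearMap.flip_apply, LinearMap.comp_apply, ← hr]
        rfl
      · rw [pairEval₃_tmul, (P.comul_iff y r).1 (hΔ' y r hr), pairEval_tmul]
  obtain ⟨w, hw, hw'⟩ := hL p
  obtain ⟨t, ht, ht'⟩ := hR q
  rw [← hw, ← ht]
  refine P.mk₃_eq_of_pairEval₃_eq hf hg hf' hg' w t fun u v z => ?_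
  rw [hw', ht', (P.comul_iff x p).1 hp, (P.comul_iff x q).1 hq, mul_assoc]

end Triple

theorem mul_comm (hB : B.IsCocommutative) (x y : R) : x * y = y * x :=
  P.ev_ext _ _ fun u => by
    obtain ⟨p, hp⟩ := B.exists_rep u
    rw [P.ev_mul x y u p hp, P.ev_mul y x u _ (hB.comul_comm u p hp)]
    clear hp
    induction p with
    | zero => simp
    | add p q hp hq => simp only [map_add, hp, hq]
    | tmul a b => simp [hB.base_comm (P.ev x a)]

theorem ev_mul_one (x y : R) : P.ev (x * y) 1 = P.ev x 1 * P.ev y 1 := by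
  rw [P.ev_mul x y 1 1 B.comul_one.symm, Algebra.TensorProduct.one_def]
  simp

theorem ev_source (a : A) (u : U) : P.ev (D.source a) u = B.counit (u * B.source a) := by
  rw [← one_mul (D.source a), P.ev_mul_source, P.ev_one]

theorem ev_target (a : A) (u : U) : P.ev (D.target (op a)) u = a * B.counit u := by
  rw [← one_mul (D.target _), P.ev_mul_target, P.ev_one]

/-- `⟨x y, u s(a b)⟩ = ⟨x, u₁ s(a)⟩ ⟨y, u₂ s(b)⟩` -/
theorem ev_mul_mul_source (hB : B.IsCocommutative) (x y : R) (u : U) (a b : A) {r : U ⊗[k] U}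
    (hr : B.mk₂ r = B.comul u) : P.ev (x * y) (u * B.source (b * a)) =
      LinearMap.mul' k A (TensorProduct.map (P.ev x) (P.ev y)
        (r * (B.source a ⊗ₜ[k] B.source b))) := by
  have h1 : B.mk₂ (r * (B.source (b * a) ⊗ₜ[k] 1)) = B.comul (u * B.source (b * a)) :=
    (B.comul_mul _ _ _ _ hr (B.comul_source _).symm).symm
  -- Δ(u s(ba)) has s(ba) in its first leg only; the Takeuchi condition moves the factor s(b) = t(b)
  -- to the second leg.
  have h2 : B.mk₂ (r * (B.source a ⊗ₜ[k] B.source b)) = B.comul (u * B.source (b * a)) := by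
    have e1 : r * (B.source a ⊗ₜ[k] B.source b) = r * (1 ⊗ₜ[k] B.source b) * (B.source a ⊗ₜ 1) := by
      rw [mul_assoc]; simp
    have e2 : r * (B.source (b * a) ⊗ₜ[k] 1) =
        r * (B.target (op b) ⊗ₜ[k] 1) * (B.source a ⊗ₜ 1) := by
      rw [mul_assoc, ← hB.source_eq_target]; simp
    rw [← h1, e1, e2]
    exact (congrArg (fun z => B.rightAct z (B.source a ⊗ₜ[k] 1)) (B.takeuchi b u r hr)).symm
  exact P.ev_mul _ _ _ _ h2

/-- The pairing of a product with (u, v) is the product of the pairings with (u₁, v₁) and (u₂, v₂).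
Since Δ(uv) = u₁v₁ ⊗ u₂v₂, this is compatible with the conditions defining the coproducts of x and
y. -/
theorem pairEval_mul (hB : B.IsCocommutative) {x y : R} {p q : R ⊗[k] R}
    (hp : ∀ u v, pairEval B P.ev u v p = P.ev x (u * v))
    (hq : ∀ u v, pairEval B P.ev u v q = P.ev y (u * v)) (u v : U) :
    pairEval B P.ev u v (p * q) = P.ev (x * y) (u * v) := by
  obtain ⟨r, hr⟩ := B.exists_rep u
  obtain ⟨t, ht⟩ := B.exists_rep v
  obtain ⟨I, hI⟩ := TensorProduct.exists_finset r
  obtain ⟨J, hJ⟩ := TensorProduct.exists_finset t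
  -- On pure tensors: (xx')(u s((yy')(v))) is expanded first along Δv, then along Δu by
  -- `ev_mul_mul_source`.
  have key : ∀ p q, pairEval B P.ev u v (p * q) =
      ∑ i ∈ I, ∑ j ∈ J, pairEval B P.ev i.1 j.1 p * pairEval B P.ev i.2 j.2 q := by
    intro p q
    induction p with
    | zero => simp
    | add p p' hp hp' => simp only [_root_.add_mul, map_add, hp, hp', Finset.sum_add_distrib]
    | tmul x y =>
      induction q with
      | zero => simp
      | add p p' hp hp' => simp only [mul_add, map_add, hp, hp', Finset.sum_add_distrib]
      | tmul x' y' =>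
        rw [Algebra.TensorProduct.tmul_mul_tmul, pairEval_tmul, P.ev_mul _ _ _ _ ht, hJ,
          Finset.sum_comm]
        simp only [map_sum, Finset.mul_sum, TensorProduct.map_tmul, LinearMap.mul'_apply]
        refine Finset.sum_congr rfl fun j _ => ?_
        rw [hB.base_comm, P.ev_mul_mul_source hB _ _ _ _ _ hr, hI, Finset.sum_mul]
        simp
  rw [key, P.ev_mul _ _ _ _ (B.comul_mul u v r t hr ht).symm, hI, hJ, Finset.sum_comm]
  simp [Finset.sum_mul, Finset.mul_sum, hp, hq]

theorem comul_mul (hB : B.IsCocommutative) {x y : R} {p q : R ⊗[k] R}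
    (hp : D.mk₂ p = D.comul x) (hq : D.mk₂ q = D.comul y) :
    D.mk₂ (p * q) = D.comul (x * y) :=
  (P.comul_iff _ _).2 (P.pairEval_mul hB ((P.comul_iff _ _).1 hp) ((P.comul_iff _ _).1 hq))

theorem comul_one : D.mk₂ 1 = D.comul 1 :=
  (P.comul_iff _ _).2 fun u v => by
    rw [Algebra.TensorProduct.one_def, pairEval_tmul, P.ev_one, P.ev_one, P.ev_one,
      ← B.counit_mul_source]

/-- With `comul_mul` this gives the bimodule law of the coproduct, multiplication by t(a)s(b) being
a special case of multiplication. -/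
theorem comul_target_source (a b : A) :
    D.mk₂ (D.target (op a) ⊗ₜ[k] D.source b) = D.comul (D.target (op a) * D.source b) :=
  (P.comul_iff _ _).2 fun u v => by
    rw [pairEval_tmul, P.ev_mul_source, P.ev_source, P.ev_target, P.ev_target,
      ← B.counit_mul_source, mul_assoc]

/-- A right bialgebroid structure on the dual of a cocommutative left bialgebroid. -/
def rightBialgebroid (hB : B.IsCocommutative) : RightBialgebroid k A R where
  toRightBialgebroidData := D
  source_mul_target _ _ := P.mul_comm hB _ _
  comul_bimodule a b v p hp := (P.comul_mul hB hp (P.comul_target_source a b)).symm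
  counit_bimodule a b v := by
    rw [P.counit_eq, P.counit_eq, P.ev_mul_one, P.ev_mul_one, P.ev_source, P.ev_target,
      B.counit_one, mul_one, one_mul, ← mul_one (B.source b), B.counit_source_mul, B.counit_one,
      mul_one, ← mul_assoc, hB.base_comm (P.ev v 1) a]
  coassoc v p hp := P.comulLeft_eq_comulRight (fun _ _ => rfl) (fun _ _ => rfl) (fun _ _ => rfl)
    (fun _ _ => rfl) _ _ (fun _ _ => id) (fun _ _ => id) hp hp
  counit_comul v p hp := by
    refine P.ev_ext _ _ fun u => ?_
    -- With first argument 1 the pairing becomes x(s(y(u))) = y(u) x(1), which is the left counit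
    -- law; the other counit law takes second argument 1.
    have h := (P.comul_iff v p).1 hp 1 u
    rw [one_mul] at h
    rw [← h]
    clear h hp
    induction p with
    | zero => simp
    | add p q hp hq => simp only [map_add, LinearMap.add_apply, hp, hq]
    | tmul x y =>
      have : P.ev x (B.source (P.ev y u)) = P.ev y u * P.ev x 1 := by
        rw [← P.ev_source_mul, mul_one]
      simp [P.ev_mul_target, P.counit_eq, this, hB.base_comm (P.ev x 1)]
  comul_counit v p hp := by
    refine P.ev_ext _ _ fun u => ?_
    have h := (P.comul_iff v p).1 hp u 1
    rw [mul_one] at h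
    rw [← h]
    clear h hp
    induction p with
    | zero => simp
    | add p q hp hq => simp only [map_add, LinearMap.add_apply, hp, hq]
    | tmul x y => simp [P.ev_mul_source, P.counit_eq]
  -- In a commutative ring the Takeuchi condition is the balancing relation itself, and holds for
  -- every `p`.
  takeuchi a v p hp := by
    clear hp
    induction p with
    | zero => simp
    | add p q hp hq => simp only [mul_add, map_add, hp, hq]
    | tmul x y =>
      rw [Algebra.TensorProduct.tmul_mul_tmul, Algebra.TensorProduct.tmul_mul_tmul, one_mul,
        one_mul, P.mul_comm hB _ x, P.mul_comm hB _ y]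
      exact BTensor.mk_balanced (k := k) (fun a : A => LinearMap.mulRight k (D.source a))
        (fun a : A => LinearMap.mulRight k (D.target (op a))) a x y
  comul_one := P.comul_one.symm
  comul_mul v w p q hp hq := (P.comul_mul hB hp hq).symm
  counit_one := by rw [P.counit_eq, P.ev_one, B.counit_one]
  counit_mul_source v w := by
    rw [P.counit_eq, P.counit_eq, P.counit_eq, P.ev_mul_one, P.ev_mul_one, P.ev_source, one_mul,
      ← mul_one (B.source _), B.counit_source_mul, B.counit_one, mul_one]
  counit_mul_target v w := by
    rw [P.counit_eq, P.counit_eq, P.counit_eq, P.ev_mul_one, P.ev_mul_one, P.ev_target,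
      B.counit_one, mul_one]

end DualPairing
end DualPairing

/-! ### Coopposites, and opposites of commutative right bialgebroids. -/

namespace RightBialgebroidData

variable {k : Type*} [CommRing k] {A : Type*} [Ring A] [Algebra k A]
  {R : Type*} [Ring R] [Algebra k R] (D : RightBialgebroidData k A R)

theorem mk₂_balanced (a : A) (x y : R) :
    D.mk₂ ((x * D.source a) ⊗ₜ[k] y) = D.mk₂ (x ⊗ₜ[k] (y * D.target (op a))) :=
  BTensor.mk_balanced (k := k) (fun a : A => LinearMap.mulRight k (D.source a))
    (fun a : A => LinearMap.mulRight k (D.target (op a))) a x y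

theorem coop_comul {x : R} {p : R ⊗[k] R} (h : D.mk₂ p = D.comul x) :
    D.coop.comul x = D.coop.mk₂ (TensorProduct.comm k R R p) := by
  rw [coop, LinearMap.comp_apply, ← h]
  rfl

theorem oppositeOfComm_source (hR : ∀ x y : R, x * y = y * x) (a : A) :
    (D.oppositeOfComm hR).source a = D.target (op a) := rfl

theorem oppositeOfComm_target (hR : ∀ x y : R, x * y = y * x) (a : A) :
    (D.oppositeOfComm hR).target (op a) = D.source a := rfl

/-- The two relation submodules are equal by commutativity, although the quotient types are not the
same term. This and the next lemma transfer statements about representatives. -/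
theorem oppositeOfComm_mk₂_eq_iff (hR : ∀ x y : R, x * y = y * x) (p q : R ⊗[k] R) :
    (D.oppositeOfComm hR).mk₂ p = (D.oppositeOfComm hR).mk₂ q ↔ D.mk₂ p = D.mk₂ q := by
  have h : balancedRel (fun a : A => LinearMap.mulLeft k ((D.oppositeOfComm hR).target (op a)))
      (fun a : A => LinearMap.mulLeft k ((D.oppositeOfComm hR).source a)) =
      balancedRel (fun a : A => LinearMap.mulRight k (D.source a))
        (fun a : A => LinearMap.mulRight k (D.target (op a))) := by
    congr 1 <;> funext a <;> ext x <;> exact hR _ _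
  exact (Submodule.Quotient.eq _).trans ((by rw [h] : _ ↔ _).trans (Submodule.Quotient.eq _).symm)

theorem oppositeOfComm_comul_iff (hR : ∀ x y : R, x * y = y * x) (x : R) (p : R ⊗[k] R) :
    (D.oppositeOfComm hR).mk₂ p = (D.oppositeOfComm hR).comul x ↔ D.mk₂ p = D.comul x := by
  obtain ⟨q, hq⟩ := Submodule.mkQ_surjective _ (D.comul x)
  have h : (D.oppositeOfComm hR).comul x = (D.oppositeOfComm hR).mk₂ q := by
    rw [oppositeOfComm, LinearMap.comp_apply, ← hq]
    rfl
  rw [h, oppositeOfComm_mk₂_eq_iff, ← hq]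

end RightBialgebroidData

namespace DualPairing

variable {k : Type*} [CommRing k] {A : Type*} [Ring A] [Algebra k A]
  {U : Type*} [Ring U] [Algebra k U] {B : LeftBialgebroid k A U}
  {R : Type*} [Ring R] [Algebra k R] {D : RightBialgebroidData k A R} (P : DualPairing B D)
include P

/-- The opposite of the (commutative) dual, as a left bialgebroid. -/
def leftBialgebroid (hB : B.IsCocommutative) : LeftBialgebroid k A R where
  toLeftBialgebroidData := D.oppositeOfComm (P.mul_comm hB)
  source_mul_target _ _ := P.mul_comm hB _ _
  comul_bimodule a b u p hp := by
    rw [D.oppositeOfComm_comul_iff] at hp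
    symm
    rw [D.oppositeOfComm_comul_iff, D.oppositeOfComm_source, D.oppositeOfComm_target]
    exact P.comul_mul hB (P.comul_target_source a b) hp
  counit_bimodule a b u := by
    rw [D.oppositeOfComm_source, D.oppositeOfComm_target, P.mul_comm hB]
    exact (P.rightBialgebroid hB).counit_bimodule a b u
  coassoc u p hp := P.comulLeft_eq_comulRight (fun _ _ => P.mul_comm hB _ _)
    (fun _ _ => P.mul_comm hB _ _) (fun _ _ => P.mul_comm hB _ _) (fun _ _ => P.mul_comm hB _ _)
    _ _ (fun x p => (D.oppositeOfComm_comul_iff _ x p).1)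
    (fun x p => (D.oppositeOfComm_comul_iff _ x p).1)
    ((D.oppositeOfComm_comul_iff _ u p).1 hp) ((D.oppositeOfComm_comul_iff _ u p).1 hp)
  counit_comul u p hp := by
    rw [← (P.rightBialgebroid hB).counit_comul u p ((D.oppositeOfComm_comul_iff _ u p).1 hp)]
    clear hp
    induction p with
    | zero => simp
    | add p q hp hq => simp only [map_add, hp, hq]
    | tmul x y => exact P.mul_comm hB _ _
  comul_counit u p hp := by
    rw [← (P.rightBialgebroid hB).comul_counit u p ((D.oppositeOfComm_comul_iff _ u p).1 hp)]
    clear hp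
    induction p with
    | zero => simp
    | add p q hp hq => simp only [map_add, hp, hq]
    | tmul x y => exact P.mul_comm hB _ _
  takeuchi a u p hp := by
    rw [D.oppositeOfComm_mk₂_eq_iff, D.oppositeOfComm_source, D.oppositeOfComm_target]
    clear hp
    induction p with
    | zero => simp
    | add p q hp hq => simp only [_root_.add_mul, map_add, hp, hq]
    | tmul x y =>
      rw [Algebra.TensorProduct.tmul_mul_tmul, Algebra.TensorProduct.tmul_mul_tmul, mul_one,
        mul_one]
      exact D.mk₂_balanced a x y
  comul_one := ((D.oppositeOfComm_comul_iff _ _ _).2 P.comul_one).symm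
  comul_mul u v p q hp hq := by
    rw [D.oppositeOfComm_comul_iff] at hp hq
    exact ((D.oppositeOfComm_comul_iff _ _ _).2 (P.comul_mul hB hp hq)).symm
  counit_one := (P.rightBialgebroid hB).counit_one
  counit_mul_source u v := by
    rw [P.mul_comm hB u, P.mul_comm hB u]
    exact (P.rightBialgebroid hB).counit_mul_target v u
  counit_mul_target u v := by
    rw [P.mul_comm hB u, P.mul_comm hB u]
    exact (P.rightBialgebroid hB).counit_mul_source v u

end DualPairing

/-! ### Transport of right bialgebroids along reversal of the tensor factors. -/

section Flip

variable {k : Type*} [CommRing k] {A : Type*} [Ring A] [Algebra k A]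
  {R : Type*} [Ring R] [Algebra k R] {R' : Type*} [Ring R'] [Algebra k R']

/-- `x ⊗ y ↦ F y ⊗ F x` -/
def flipCongr (F : R' ≃ₐ[k] R) : R' ⊗[k] R' ≃ₐ[k] R ⊗[k] R :=
  (Algebra.TensorProduct.comm k R' R').trans (Algebra.TensorProduct.congr F F)

@[simp] theorem flipCongr_tmul (F : R' ≃ₐ[k] R) (x y : R') :
    flipCongr F (x ⊗ₜ y) = F y ⊗ₜ F x := rfl

@[simp] theorem flipCongr_symm_tmul (F : R' ≃ₐ[k] R) (x y : R) :
    (flipCongr F).symm (x ⊗ₜ y) = F.symm y ⊗ₜ F.symm x := rfl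

theorem flipCongr_symm_flipCongr (F : R' ≃ₐ[k] R) (p : R' ⊗[k] R') :
    flipCongr F.symm (flipCongr F p) = p := by
  induction p with
  | zero => simp
  | add p q hp hq => rw [map_add, map_add, hp, hq]
  | tmul x y => simp

theorem comm_flipCongr (F : R' ≃ₐ[k] R) (p : R' ⊗[k] R') :
    TensorProduct.comm k R R (flipCongr F p) =
      TensorProduct.map F.toLinearMap F.toLinearMap p := by
  induction p with
  | zero => simp
  | add p q hp hq => rw [map_add, map_add, map_add, hp, hq]
  | tmul x y => simp

/-- `x ⊗ y ⊗ z ↦ F⁻¹ z ⊗ F⁻¹ y ⊗ F⁻¹ x` -/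
def flipCongr₃ (F : R' ≃ₐ[k] R) : R ⊗[k] (R ⊗[k] R) →ₗ[k] R' ⊗[k] (R' ⊗[k] R') :=
  (TensorProduct.assoc k R' R' R').toLinearMap ∘ₗ
    (TensorProduct.comm k R' (R' ⊗[k] R')).toLinearMap ∘ₗ
    TensorProduct.map F.symm.toLinearMap (flipCongr F).symm.toLinearMap

theorem flipCongr₃_tmul (F : R' ≃ₐ[k] R) (x : R) (q : R ⊗[k] R) :
    flipCongr₃ F (x ⊗ₜ q) =
      TensorProduct.assoc k R' R' R' ((flipCongr F).symm q ⊗ₜ F.symm x) := rfl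

theorem flipCongr₃_assoc (F : R' ≃ₐ[k] R) (q : R ⊗[k] R) (z : R) :
    flipCongr₃ F (TensorProduct.assoc k R R R (q ⊗ₜ z)) = F.symm z ⊗ₜ (flipCongr F).symm q := by
  induction q with
  | zero => simp
  | add p q hp hq => simp only [TensorProduct.add_tmul, TensorProduct.tmul_add, map_add, hp, hq]
  | tmul x y => simp [flipCongr₃_tmul]

/-- Reversing three factors exchanges Δ ⊗ id with id ⊗ Δ, so coassociativity for `D` is that for `W`
read backwards. -/
theorem coassoc_of_flip (W : RightBialgebroid k A R) (D : RightBialgebroidData k A R')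
    (F : R' ≃ₐ[k] R) (hs : ∀ a, F (D.source a) = W.target (op a))
    (ht : ∀ a, F (D.target (op a)) = W.source a)
    (hΔ : ∀ x p, D.mk₂ p = D.comul x ↔ W.mk₂ (flipCongr F p) = W.comul (F x))
    (v : R') (p : R' ⊗[k] R') (hp : D.mk₂ p = D.comul v) :
    comulLeft D.comul (fun a : A => LinearMap.mulRight k (D.source a))
        (fun a : A => LinearMap.mulRight k (D.target (op a))) p =
      comulRight (fun a : A => LinearMap.mulRight k (D.source a))
        (fun a : A => LinearMap.mulRight k (D.target (op a))) D.comul p := by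
  have hs' : ∀ a, F.symm (W.target (op a)) = D.source a := fun a => by
    rw [← hs, F.symm_apply_apply]
  have ht' : ∀ a, F.symm (W.source a) = D.target (op a) := fun a => by
    rw [← ht, F.symm_apply_apply]
  let T : BTensor₃ (fun a : A => LinearMap.mulRight k (W.source a))
      (fun a : A => LinearMap.mulRight k (W.target (op a)))
      (fun a : A => LinearMap.mulRight k (W.source a))
      (fun a : A => LinearMap.mulRight k (W.target (op a))) →ₗ[k]
      BTensor₃ (fun a : A => LinearMap.mulRight k (D.source a))
      (fun a : A => LinearMap.mulRight k (D.target (op a)))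
      (fun a : A => LinearMap.mulRight k (D.source a))
      (fun a : A => LinearMap.mulRight k (D.target (op a))) :=
    Submodule.mapQ _ _ (flipCongr₃ F) (by
      refine Submodule.span_le.2 ?_
      rintro _ (⟨a, x, y, z, rfl⟩ | ⟨a, x, y, z, rfl⟩)
      -- A relation between the first two factors becomes one between the last two with its terms
      -- interchanged, hence the sign.
      · refine Submodule.neg_mem_iff _ |>.1 (Submodule.subset_span (Or.inr
          ⟨a, F.symm z, F.symm y, F.symm x, ?_⟩))
        simp [flipCongr₃_tmul, hs', ht']
      · refine Submodule.neg_mem_iff _ |>.1 (Submodule.subset_span (Or.inl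
          ⟨a, F.symm z, F.symm y, F.symm x, ?_⟩))
        simp [flipCongr₃_tmul, hs', ht'])
  have hL : ∀ p, comulLeft D.comul (fun a : A => LinearMap.mulRight k (D.source a))
      (fun a : A => LinearMap.mulRight k (D.target (op a))) p =
      T (comulRight (fun a : A => LinearMap.mulRight k (W.source a))
        (fun a : A => LinearMap.mulRight k (W.target (op a))) W.comul (flipCongr F p)) := by
    intro p
    induction p with
    | zero => simp
    | add p q hp hq => simp only [map_add, hp, hq]
    | tmul x y =>
      obtain ⟨r, hr⟩ := Submodule.mkQ_surjective _ (D.comul x)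
      rw [flipCongr_tmul, comulLeft, comulRight, TensorProduct.lift.tmul, TensorProduct.lift.tmul,
        LinearMap.flip_apply, LinearMap.comp_apply, LinearMap.comp_apply, ← (hΔ x r).1 hr, ← hr]
      change Submodule.mkQ _ (TensorProduct.assoc k R' R' R' (r ⊗ₜ y)) =
        Submodule.mkQ _ (flipCongr₃ F (F y ⊗ₜ flipCongr F r))
      rw [flipCongr₃_tmul, AlgEquiv.symm_apply_apply, AlgEquiv.symm_apply_apply]
  have hR : ∀ p, comulRight (fun a : A => LinearMap.mulRight k (D.source a))
      (fun a : A => LinearMap.mulRight k (D.target (op a))) D.comul p =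
      T (comulLeft W.comul (fun a : A => LinearMap.mulRight k (W.source a))
        (fun a : A => LinearMap.mulRight k (W.target (op a))) (flipCongr F p)) := by
    intro p
    induction p with
    | zero => simp
    | add p q hp hq => simp only [map_add, hp, hq]
    | tmul x y =>
      obtain ⟨r, hr⟩ := Submodule.mkQ_surjective _ (D.comul y)
      rw [flipCongr_tmul, comulLeft, comulRight, TensorProduct.lift.tmul, TensorProduct.lift.tmul,
        LinearMap.flip_apply, LinearMap.comp_apply, LinearMap.comp_apply, ← (hΔ y r).1 hr, ← hr]
      change Submodule.mkQ _ (x ⊗ₜ r) =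
        Submodule.mkQ _ (flipCongr₃ F (TensorProduct.assoc k R R R (flipCongr F r ⊗ₜ F x)))
      rw [flipCongr₃_assoc, AlgEquiv.symm_apply_apply, AlgEquiv.symm_apply_apply]
  rw [hL, hR, W.coassoc (F v) _ ((hΔ v p).1 hp)]

/-- The coopposite of a commutative right bialgebroid over a commutative base, transported
along an isomorphism. -/
def RightBialgebroid.ofFlip (W : RightBialgebroid k A R) (D : RightBialgebroidData k A R')
    (F : R' ≃ₐ[k] R) (hA : ∀ a b : A, a * b = b * a) (hR : ∀ x y : R', x * y = y * x)
    (hs : ∀ a, F (D.source a) = W.target (op a)) (ht : ∀ a, F (D.target (op a)) = W.source a)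
    (hc : ∀ x, W.counit (F x) = D.counit x)
    (hΔ : ∀ x p, D.mk₂ p = D.comul x ↔ W.mk₂ (flipCongr F p) = W.comul (F x)) :
    RightBialgebroid k A R' where
  toRightBialgebroidData := D
  source_mul_target _ _ := hR _ _
  comul_bimodule a b v p hp := by
    symm
    rw [hΔ] at hp ⊢
    rw [map_mul (flipCongr F), map_mul F, map_mul F, flipCongr_tmul, hs, ht, W.source_mul_target,
      W.comul_bimodule b a _ _ hp]
  counit_bimodule a b v := by
    rw [← hc, map_mul F, map_mul F, hs, ht, ← hc, W.source_mul_target, W.counit_bimodule,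
      hA _ a, hA b, mul_assoc]
  coassoc := coassoc_of_flip W D F hs ht hΔ
  -- The flip exchanges the two counit laws, and likewise source and target in the axioms below.
  counit_comul v p hp := by
    refine F.injective ?_
    conv_rhs => rw [← W.comul_counit _ _ ((hΔ v p).1 hp)]
    clear hp
    induction p with
    | zero => simp
    | add p q hp hq => simp only [map_add, hp, hq]
    | tmul x y => simp [ht, hc]
  comul_counit v p hp := by
    refine F.injective ?_
    conv_rhs => rw [← W.counit_comul _ _ ((hΔ v p).1 hp)]
    clear hp
    induction p with
    | zero => simp
    | add p q hp hq => simp only [map_add, hp, hq]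
    | tmul x y => simp [hs, hc]
  takeuchi a v p hp := by
    clear hp
    induction p with
    | zero => simp
    | add p q hp hq => simp only [mul_add, map_add, hp, hq]
    | tmul x y =>
      rw [Algebra.TensorProduct.tmul_mul_tmul, Algebra.TensorProduct.tmul_mul_tmul, one_mul,
        one_mul, hR _ x, hR _ y]
      exact D.mk₂_balanced a x y
  comul_one := by
    symm
    rw [hΔ, map_one (flipCongr F), map_one F, W.comul_one]
  comul_mul v w p q hp hq := by
    symm
    rw [hΔ] at hp hq ⊢
    rw [map_mul (flipCongr F), map_mul F, W.comul_mul _ _ _ _ hp hq]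
  counit_one := by rw [← hc, map_one, W.counit_one]
  counit_mul_source v w := by
    rw [← hc, map_mul F, W.counit_mul_target, ← hc (_ * _), map_mul F, hs, hc]
  counit_mul_target v w := by
    rw [← hc, map_mul F, W.counit_mul_source, ← hc (_ * _), map_mul F, ht, hc]

end Flip

/-! ### The right dual as an instance of the abstract pairing. -/

namespace LeftBialgebroid.IsCocommutative

variable {k : Type*} [CommRing k] {A : Type*} [Ring A] [Algebra k A]
  {U : Type*} [Ring U] [Algebra k U] {B : LeftBialgebroid k A U}

/-- The pairing of the right dual with a cocommutative left bialgebroid. -/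
def dualPairing (hB : B.IsCocommutative) (h : B.RightFGProjective) :
    DualPairing B (rightDualData h) where
  base_comm := hB.base_comm
  ev := B.rightDual.subtype
  ev_ext _ _ := rightDual_ext
  ev_mul x y u p hp := hB.rightDual_mul_apply x y hp
  ev_one _ := rfl
  ev_source_mul := hB.rightDual_source_mul
  ev_mul_source x a u := by
    rw [hB.source_eq_target a]
    exact rightDual_mul_source_apply h x a u
  ev_mul_target := rightDual_mul_target_apply h
  counit_eq _ := rfl
  comul_iff x p := by
    refine (rightDualData_comul_iff h x p).trans ?_
    have e : ∀ u v, B.rightEval u v = pairEval B B.rightDual.subtype u v := fun u v => by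
      refine TensorProduct.ext' fun y z => ?_
      change y.1 (u * B.target (op (z.1 v))) = y.1 (u * B.source (z.1 v))
      rw [hB.source_eq_target]
    simp only [e]
    rfl
  n := h.nonempty.some.n
  vec := h.nonempty.some.vec
  coord := h.nonempty.some.coord
  sum_eq u := by
    simp only [hB.source_eq_target]
    exact h.nonempty.some.sum_eq u

end LeftBialgebroid.IsCocommutative

/-! ### Equivariance of α_ℓ and identities for the translation map. -/

namespace LeftBialgebroid

variable {k : Type*} [CommRing k] {A : Type*} [Ring A] [Algebra k A]
  {U : Type*} [Ring U] [Algebra k U] {B : LeftBialgebroid k A U}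

/-- The projection of `U ⊗[k] U` onto the source of `α_ℓ`. -/
abbrev hopfMk (B : LeftBialgebroid k A U) : U ⊗[k] U →ₗ[k] B.HopfSource :=
  BTensor.mk (fun a : A => LinearMap.mulRight k (B.target (op a)))
    (fun a : A => LinearMap.mulLeft k (B.target (op a)))

/-- α_ℓ is linear for right multiplication on the second factor. With α_ℓ(u₊ ⊗ u₋) = u ⊗ 1 this
evaluates α_ℓ(u₊ ⊗ u₋y) = u ⊗ y. -/
theorem galoisLeft_mul_one_tmul (p : U ⊗[k] U) (y : U) :
    B.galoisLeft (B.hopfMk (p * (1 ⊗ₜ y))) =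
      B.rightAct (B.galoisLeft (B.hopfMk p)) (1 ⊗ₜ y) := by
  induction p with
  | zero => simp
  | add p q hp hq => simp only [add_mul, map_add, LinearMap.add_apply, hp, hq]
  | tmul a b =>
    obtain ⟨r, hr⟩ := B.exists_rep a
    rw [Algebra.TensorProduct.tmul_mul_tmul, mul_one, galoisLeft_mk, galoisLeft_mk, ← hr,
      rightAct_mk, rightAct_mk]
    change _ = B.mk₂ (r * (1 ⊗ₜ[k] b) * (1 ⊗ₜ[k] y))
    rw [mul_assoc]
    simp

theorem galoisLeft_mul_source_tmul (p : U ⊗[k] U) (a : A) :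
    B.galoisLeft (B.hopfMk (p * (B.source a ⊗ₜ 1))) =
      B.rightAct (B.galoisLeft (B.hopfMk p)) (B.source a ⊗ₜ 1) := by
  induction p with
  | zero => simp
  | add p q hp hq => simp only [add_mul, map_add, LinearMap.add_apply, hp, hq]
  | tmul x y =>
    obtain ⟨r, hr⟩ := B.exists_rep x
    rw [Algebra.TensorProduct.tmul_mul_tmul, mul_one, galoisLeft_mk, galoisLeft_mk,
      B.rightAct_comul_mul _ _ _ _ (B.comul_source a).symm, ← hr, rightAct_mk, rightAct_mk]
    change _ = B.mk₂ (r * (1 ⊗ₜ[k] y) * (B.source a ⊗ₜ[k] 1))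
    rw [mul_assoc]
    simp

/-- `v ⊗ w ↦ x₁ v ⊗ x₂ w`, which is well defined by the Takeuchi condition. -/
def comulAct (B : LeftBialgebroid k A U) (x : U) :
    BTensor (fun a : A => LinearMap.mulLeft k (B.target (op a)))
      (fun a : A => LinearMap.mulLeft k (B.source a)) →ₗ[k]
    BTensor (fun a : A => LinearMap.mulLeft k (B.target (op a)))
      (fun a : A => LinearMap.mulLeft k (B.source a)) :=
  Submodule.liftQ _ (B.rightAct (B.comul x)) (balancedRel_le_ker _ _ _ fun a v w => by
    obtain ⟨r, hr⟩ := B.exists_rep x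
    have h := congrArg (fun z => B.rightAct z (v ⊗ₜ[k] w)) (B.takeuchi a x r hr)
    change B.mk₂ (r * (B.target (op a) ⊗ₜ[k] 1) * (v ⊗ₜ[k] w)) =
      B.mk₂ (r * (1 ⊗ₜ[k] B.source a) * (v ⊗ₜ[k] w)) at h
    rw [← hr, rightAct_mk, rightAct_mk]
    simpa [mul_assoc] using h)

theorem comulAct_mk (x : U) (p : U ⊗[k] U) : B.comulAct x (B.mk₂ p) = B.rightAct (B.comul x) p :=
  rfl

/-- Left multiplication by x on the first factor becomes the action of Δx, by multiplicativity of Δ.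
Hence α_ℓ(x y₊ ⊗ y₋) = x₁y ⊗ x₂. -/
theorem galoisLeft_tmul_one_mul (x : U) (p : U ⊗[k] U) :
    B.galoisLeft (B.hopfMk ((x ⊗ₜ 1) * p)) = B.comulAct x (B.galoisLeft (B.hopfMk p)) := by
  induction p with
  | zero => simp
  | add p q hp hq => simp only [mul_add, map_add, hp, hq]
  | tmul a b =>
    obtain ⟨r, hr⟩ := B.exists_rep a
    rw [Algebra.TensorProduct.tmul_mul_tmul, one_mul, galoisLeft_mk, galoisLeft_mk,
      B.rightAct_comul_mul _ _ _ _ hr, ← hr, rightAct_mk, comulAct_mk]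

theorem upperContract_tmul (φ : B.rightDual) (x y : U) :
    upperContract φ (B.hopfMk (x ⊗ₜ y)) = B.counit (x * B.target (op (φ.1 y))) := rfl

theorem upperContract_source_mul (φ : B.rightDual) (a : A) (p : U ⊗[k] U) :
    upperContract φ (B.hopfMk ((B.source a ⊗ₜ 1) * p)) = a * upperContract φ (B.hopfMk p) := by
  induction p with
  | zero => simp
  | add p q hp hq => simp only [mul_add, map_add, hp, hq]
  | tmul x y =>
    rw [Algebra.TensorProduct.tmul_mul_tmul, one_mul, upperContract_tmul, upperContract_tmul,
      mul_assoc, counit_source_mul]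

/-- Multiplication factors through α_ℓ by the counit law: xy = s(ε(x₁)) x₂y. Its use is u₊u₋ =
s(ε(u)). -/
theorem mul_eq_of_galoisLeft_eq (p q : U ⊗[k] U) (h : B.galoisLeft (B.hopfMk p) = B.mk₂ q) :
    LinearMap.mul' k U p = rightContract (1 : B.rightDual) q := by
  let L : BTensor (fun a : A => LinearMap.mulLeft k (B.target (op a)))
      (fun a : A => LinearMap.mulLeft k (B.source a)) →ₗ[k] U :=
    Submodule.liftQ _ (rightContract (1 : B.rightDual)) (balancedRel_le_ker _ _ _ fun a x y => by
      simp [rightDual_apply, mul_assoc])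
  have key : ∀ p, LinearMap.mul' k U p = L (B.galoisLeft (B.hopfMk p)) := by
    intro p
    induction p with
    | zero => simp
    | add p q hp hq => simp only [map_add, hp, hq]
    | tmul x y =>
      obtain ⟨r, hr⟩ := B.exists_rep x
      rw [galoisLeft_mk, ← hr]
      change _ = rightContract (1 : B.rightDual) (r * (1 ⊗ₜ[k] y))
      have h : rightContract (1 : B.rightDual) r = x := B.counit_comul x r hr
      rw [LinearMap.mul'_apply, ← h]
      clear hr h
      induction r with
      | zero => simp
      | add p q hp hq => simp only [add_mul, map_add, hp, hq]
      | tmul a b => simp [mul_assoc]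
  rw [key, h]
  rfl

namespace IsLeftHopf

variable (hl : B.IsLeftHopf)
include hl

theorem hopfMk_eq_iff (p q : U ⊗[k] U) :
    B.hopfMk p = B.hopfMk q ↔ B.galoisLeft (B.hopfMk p) = B.galoisLeft (B.hopfMk q) :=
  hl.1.eq_iff.symm

theorem galoisLeft_of_rep {u : U} {p : U ⊗[k] U} (hp : B.hopfMk p = hl.translation u) :
    B.galoisLeft (B.hopfMk p) = B.mk₂ (u ⊗ₜ 1) := by
  rw [hp, hl.translation_spec]

/-- `u₊ ⊗ u₋ s(a) = s(a) u₊ ⊗ u₋` -/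
theorem mul_one_tmul_source {u : U} {p : U ⊗[k] U} (hp : B.hopfMk p = hl.translation u) (a : A)
    (hB : B.IsCocommutative) :
    B.hopfMk (p * (1 ⊗ₜ B.source a)) = B.hopfMk ((B.source a ⊗ₜ 1) * p) := by
  rw [hl.hopfMk_eq_iff, galoisLeft_mul_one_tmul, galoisLeft_source_mul a p _
    (hl.galoisLeft_of_rep hp), hl.galoisLeft_of_rep hp]
  change B.mk₂ ((u ⊗ₜ[k] 1) * (1 ⊗ₜ[k] B.source a)) = _
  -- After α_ℓ the claim reads u ⊗ s(a) = s(a)u ⊗ 1, the balancing relation for s = t.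
  have h := B.mk₂_balanced a u 1
  rw [← hB.source_eq_target] at h
  simpa using h.symm

/-- `(u s(a))₊ ⊗ (u s(a))₋ = u₊ s(a) ⊗ u₋` -/
theorem translation_mul_source {u : U} {p : U ⊗[k] U} (hp : B.hopfMk p = hl.translation u)
    (a : A) : B.hopfMk (p * (B.source a ⊗ₜ 1)) = hl.translation (u * B.source a) := by
  refine hl.1 ?_
  rw [hl.translation_spec, galoisLeft_mul_source_tmul, hl.galoisLeft_of_rep hp]
  change B.mk₂ ((u ⊗ₜ[k] 1) * (B.source a ⊗ₜ[k] 1)) = _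
  simp

end IsLeftHopf

end LeftBialgebroid

/-! ### The antipode of the dual. -/

namespace LeftBialgebroid.IsCocommutative

variable {k : Type*} [CommRing k] {A : Type*} [Ring A] [Algebra k A]
  {U : Type*} [Ring U] [Algebra k U] {B : LeftBialgebroid k A U}
  (hB : B.IsCocommutative) (hl : B.IsLeftHopf)

/-- The antipode `φ ↦ ε(u₊ t(φ(u₋)))` of the dual. -/
def antipode : B.rightDual →ₗ[k] B.rightDual where
  toFun φ := hB.dualEquiv.symm (upperS hl φ)
  map_add' φ φ' := rightDual_ext fun u => by
    obtain ⟨p, hp⟩ := Submodule.mkQ_surjective _ (hl.translation u)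
    change upperContract (φ + φ') (hl.translation u) =
      upperContract φ (hl.translation u) + upperContract φ' (hl.translation u)
    rw [← hp]
    clear hp
    induction p with
    | zero => simp
    | add p q hp hq => simp only [map_add, hp, hq]; abel
    | tmul x y =>
      change B.counit (x * B.target (op (φ.1 y + φ'.1 y))) =
        B.counit (x * B.target (op (φ.1 y))) + B.counit (x * B.target (op (φ'.1 y)))
      simp [mul_add]
  map_smul' c φ := rightDual_ext fun u => by
    obtain ⟨p, hp⟩ := Submodule.mkQ_surjective _ (hl.translation u)
    change upperContract (c • φ) (hl.translation u) = c • upperContract φ (hl.translation u)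
    rw [← hp]
    clear hp
    induction p with
    | zero => simp
    | add p q hp hq => simp only [map_add, smul_add, hp, hq]
    | tmul x y =>
      change B.counit (x * B.target (op (c • φ.1 y))) = c • B.counit (x * B.target (op (φ.1 y)))
      simp

theorem antipode_apply (φ : B.rightDual) (u : U) :
    (hB.antipode hl φ).1 u = upperContract φ (hl.translation u) := rfl

-- A representative of α_ℓ⁻¹(u ⊗ 1) also represents α_r⁻¹(1 ⊗ u), by α_r = flip ∘ α_ℓ. This makes
-- S_* agree with S^* and drives the proof that S is involutive.
include hB in
theorem galoisRight_of_rep {u : U} {p : U ⊗[k] U} (hp : B.hopfMk p = hl.translation u) :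
    B.galoisRight (BTensor.mk _ _ p) = B.mk₂ (1 ⊗ₜ u) := by
  have h := hB.galoisRight_eq_flip (B.hopfMk p)
  rw [hl.galoisLeft_of_rep hp, flip_mk, TensorProduct.comm_tmul] at h
  exact h

theorem lowerS_dualEquiv (hr : B.IsRightHopf) (φ : B.rightDual) :
    lowerS hr (hB.dualEquiv φ) = hB.antipode hl φ := rightDual_ext fun u => by
  obtain ⟨p, hp⟩ := Submodule.mkQ_surjective _ (hl.translation u)
  have h : hr.translation u = BTensor.mk _ _ p := hr.1 (by
    rw [hr.translation_spec, hB.galoisRight_of_rep hl hp])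
  rw [antipode_apply, ← hp]
  change lowerContract (hB.dualEquiv φ) (hr.translation u) = _
  rw [h]
  clear h hp
  induction p with
  | zero => simp
  | add p q hp hq => simp only [map_add, hp, hq]
  | tmul x y =>
    change B.counit (x * B.source (φ.1 y)) = B.counit (x * B.target (op (φ.1 y)))
    rw [hB.source_eq_target]

/-- Unfolding twice, S²(φ)(u) is φ contracted with u₊u₋₊ ⊗ u₋₋. This element equals 1 ⊗ u, whose
contraction is ε(t(φ(u))) = φ(u). -/
theorem antipode_antipode (φ : B.rightDual) : hB.antipode hl (hB.antipode hl φ) = φ :=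
  rightDual_ext fun u => by
    obtain ⟨p, hp⟩ := Submodule.mkQ_surjective _ (hl.translation u)
    have hsurj : ∀ y : U, ∃ q, B.hopfMk q = hl.translation y := fun y =>
      Submodule.mkQ_surjective _ _
    choose w hw using hsurj
    obtain ⟨I, hI⟩ := TensorProduct.exists_finset p
    -- The image of u₊u₋₊ ⊗ u₋₋ under α_ℓ is u₊₁u₋ ⊗ u₊₂. This is α_r(u₊ ⊗ u₋), hence 1 ⊗ u.
    have h1 : ∑ i ∈ I, B.hopfMk ((i.1 ⊗ₜ 1) * w i.2) = B.hopfMk (1 ⊗ₜ u) := by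
      refine hl.1 ?_
      have h2 := hB.galoisRight_of_rep hl hp
      rw [hI] at h2
      simp only [map_sum, galoisRight_mk] at h2
      rw [map_sum, galoisLeft_mk, B.comul_one, rightAct_mk, one_mul, ← h2]
      refine Finset.sum_congr rfl fun i _ => ?_
      rw [galoisLeft_tmul_one_mul, hl.galoisLeft_of_rep (hw i.2), comulAct_mk]
    -- The nested counits collapse by ε(x t(ε(v))) = ε(xv).
    have h3 : ∀ (x : U) (q : U ⊗[k] U),
        B.counit (x * B.target (op (upperContract φ (B.hopfMk q)))) =
          upperContract φ (B.hopfMk ((x ⊗ₜ 1) * q)) := by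
      intro x q
      induction q with
      | zero => simp
      | add p q hp hq => simp only [mul_add, map_add, MulOpposite.op_add, hp, hq]
      | tmul y z =>
        rw [Algebra.TensorProduct.tmul_mul_tmul, one_mul, upperContract_tmul, upperContract_tmul,
          ← B.counit_mul_target, mul_assoc]
    rw [antipode_apply, ← hp, hI, map_sum, map_sum]
    have h4 : ∀ i : U × U, upperContract (hB.antipode hl φ) (B.hopfMk (i.1 ⊗ₜ i.2)) =
        upperContract φ (B.hopfMk ((i.1 ⊗ₜ 1) * w i.2)) := fun i => by
      rw [upperContract_tmul, antipode_apply, ← hw, h3]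
    refine (Finset.sum_congr rfl fun i _ => h4 i).trans ?_
    rw [← map_sum, h1, upperContract_tmul, one_mul, ← mul_one (B.target _), counit_target_mul,
      B.counit_one, one_mul]

variable (pr : B.RightFGProjective)

/-- `S(φ s^*(a) t^*(b)) = S(φ) s^*(b) t^*(a)` -/
theorem antipode_mul_source_mul_target (φ : B.rightDual) (a b : A) :
    hB.antipode hl (φ * (rightDualData pr).source a * (rightDualData pr).target (op b)) =
      hB.antipode hl φ * (rightDualData pr).source b * (rightDualData pr).target (op a) :=
  rightDual_ext fun u => by
    obtain ⟨p, hp⟩ := Submodule.mkQ_surjective _ (hl.translation u)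
    -- On the right-hand side b turns u₊ into u₊s(b), and the outer scalar a becomes s(a)u₊ ⊗ u₋ =
    -- u₊ ⊗ u₋s(a). Both sides are then contractions of the same representative `p`.
    rw [rightDual_mul_target_apply, rightDual_mul_source_apply, antipode_apply, antipode_apply,
      ← hB.source_eq_target, ← hl.translation_mul_source hp, ← upperContract_source_mul,
      ← hl.mul_one_tmul_source (hl.translation_mul_source hp b) a hB, mul_assoc p, ← hp]
    change upperContract _ (B.hopfMk p) = _
    clear hp
    induction p with
    | zero => simp
    | add p q hp hq => simp only [add_mul, map_add, hp, hq]
    | tmul x y =>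
      simp only [Algebra.TensorProduct.tmul_mul_tmul, one_mul, mul_one]
      rw [upperContract_tmul, upperContract_tmul, rightDual_mul_target_apply,
        rightDual_mul_source_apply, ← hB.source_eq_target, ← hB.source_eq_target,
        map_mul B.source, mul_assoc, hB.source_eq_target (φ.1 _)]

include hB in
theorem mul_apply_of_rep (φ φ' : B.rightDual) {u : U} {I : Finset (U × U)}
    (hI : B.mk₂ (∑ i ∈ I, i.1 ⊗ₜ[k] i.2) = B.comul u) :
    (φ * φ').1 u = ∑ i ∈ I, φ.1 i.1 * φ'.1 i.2 := by
  rw [hB.rightDual_mul_apply φ φ' hI]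
  simp

/-- At u the left side is ε(u₁₊ t(φ₁(u₁₋ s(φ₂(u₂))))) = ε(u₁₊ t(φ(u₁₋u₂))), and u₁₊ ⊗ u₁₋u₂ = u ⊗ 1.
-/
theorem antipode_mul (φ : B.rightDual) (p : B.rightDual ⊗[k] B.rightDual)
    (hp : (rightDualData pr).mk₂ p = (rightDualData pr).comul φ) :
    LinearMap.mul' k B.rightDual (TensorProduct.map (hB.antipode hl) LinearMap.id p) =
      (rightDualData pr).source (φ.1 1) := by
  refine rightDual_ext fun u => ?_
  have hp' := (rightDualData_comul_iff pr φ p).1 hp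
  have hsurj : ∀ y : U, ∃ J : Finset (U × U), B.hopfMk (∑ j ∈ J, j.1 ⊗ₜ j.2) =
      hl.translation y := fun y => by
    obtain ⟨q, hq⟩ := Submodule.mkQ_surjective _ (hl.translation y)
    obtain ⟨J, rfl⟩ := TensorProduct.exists_finset q
    exact ⟨J, hq⟩
  choose J hJ using hsurj
  obtain ⟨r, hr⟩ := B.exists_rep u
  obtain ⟨I, rfl⟩ := TensorProduct.exists_finset r
  -- The scalar y(u₂) is absorbed into u₁₋ by `mul_one_tmul_source`, which brings out the pairing
  -- that characterises the coproduct.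
  have key : ∀ p, (LinearMap.mul' k B.rightDual
      (TensorProduct.map (hB.antipode hl) LinearMap.id p)).1 u =
      ∑ i ∈ I, ∑ j ∈ J i.1, B.counit (j.1 * B.target (op (B.rightEval j.2 i.2 p))) := by
    intro p
    induction p with
    | zero =>
      rw [map_zero, map_zero]
      simp
    | add p q hp hq =>
      rw [map_add, map_add]
      refine (congrArg₂ (· + ·) hp hq).trans ?_
      simp only [map_add, MulOpposite.op_add, mul_add, Finset.sum_add_distrib]
    | tmul x y =>
      change (hB.antipode hl x * y).1 u = _
      rw [hB.mul_apply_of_rep _ _ hr]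
      refine Finset.sum_congr rfl fun i _ => ?_
      rw [hB.base_comm, antipode_apply, ← hJ, ← upperContract_source_mul,
        ← hl.mul_one_tmul_source (hJ i.1) _ hB, Finset.sum_mul, map_sum, map_sum]
      refine Finset.sum_congr rfl fun j _ => ?_
      rw [Algebra.TensorProduct.tmul_mul_tmul, mul_one, upperContract_tmul, hB.source_eq_target]
      rfl
  -- Under α_ℓ the left side becomes u₁ ⊗ u₂, that is Δu = α_ℓ(u ⊗ 1).
  have h1 : ∑ i ∈ I, ∑ j ∈ J i.1, B.hopfMk (j.1 ⊗ₜ (j.2 * i.2)) = B.hopfMk (u ⊗ₜ 1) := by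
    refine hl.1 ?_
    rw [galoisLeft_mk, ← hr, map_sum, rightAct_mk, ← Algebra.TensorProduct.one_def, mul_one,
      map_sum]
    refine Finset.sum_congr rfl fun i _ => ?_
    have h2 := galoisLeft_mul_one_tmul (B := B) (∑ j ∈ J i.1, j.1 ⊗ₜ j.2) i.2
    rw [hl.galoisLeft_of_rep (hJ i.1), rightAct_mk, Finset.sum_mul] at h2
    simpa using h2
  rw [key]
  simp only [hp']
  change _ = B.counit (u * B.source (φ.1 1))
  rw [hB.source_eq_target, ← upperContract_tmul, ← h1]
  simp only [map_sum, upperContract_tmul]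

/-- `x ⊗ y ⊗ z ↦ φ(x) φ'(α_ℓ⁻¹(y ⊗ z v))`, where `φ'` is contracted with `α_ℓ⁻¹`. -/
def contract₃ (φ φ' : B.rightDual) (v : U) :
    BTensor₃ (fun a : A => LinearMap.mulLeft k (B.target (op a)))
      (fun a : A => LinearMap.mulLeft k (B.source a))
      (fun a : A => LinearMap.mulLeft k (B.target (op a)))
      (fun a : A => LinearMap.mulLeft k (B.source a)) →ₗ[k] A :=
  Submodule.liftQ _ (LinearMap.mul' k A ∘ₗ TensorProduct.map φ.1
    (upperContract φ' ∘ₗ (LinearEquiv.ofBijective B.galoisLeft hl).symm.toLinearMap ∘ₗ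
      B.mk₂ ∘ₗ LinearMap.mulRight k (1 ⊗ₜ[k] v))) (by
    -- α_ℓ, hence its inverse, is linear for s(a) acting on the first factor; this balances x
    -- against y, while balancing y against z is built into `B.mk₂`.
    have hs : ∀ a q, upperContract φ' ((LinearEquiv.ofBijective B.galoisLeft hl).symm
        (B.mk₂ ((B.source a ⊗ₜ 1) * q))) =
        a * upperContract φ' ((LinearEquiv.ofBijective B.galoisLeft hl).symm (B.mk₂ q)) := by
      intro a q
      obtain ⟨p, hp⟩ := Submodule.mkQ_surjective _
        ((LinearEquiv.ofBijective B.galoisLeft hl).symm (B.mk₂ q))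
      have h := galoisLeft_source_mul a p q (by
        rw [hp]
        exact LinearEquiv.apply_symm_apply (LinearEquiv.ofBijective B.galoisLeft hl) _)
      rw [← h, ← hp, ← upperContract_source_mul]
      congr 1
      exact (LinearEquiv.symm_apply_eq _).2 rfl
    refine Submodule.span_le.2 ?_
    rintro _ (⟨a, x, y, z, rfl⟩ | ⟨a, x, y, z, rfl⟩)
    · have h := hs a (y ⊗ₜ (z * v))
      simp only [Algebra.TensorProduct.tmul_mul_tmul, one_mul] at h
      simp only [SetLike.mem_coe, LinearMap.mem_ker, map_sub, sub_eq_zero, LinearMap.comp_apply,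
        TensorProduct.map_tmul, LinearMap.mulRight_apply, LinearMap.mulLeft_apply,
        Algebra.TensorProduct.tmul_mul_tmul, mul_one, mul_assoc, LinearMap.mul'_apply,
        LinearEquiv.coe_coe, rightDual_apply, h]
    · have h := B.mk₂_balanced a y (z * v)
      simp only [SetLike.mem_coe, LinearMap.mem_ker, map_sub, sub_eq_zero, LinearMap.comp_apply,
        TensorProduct.map_tmul, LinearMap.mulRight_apply, LinearMap.mulLeft_apply,
        Algebra.TensorProduct.tmul_mul_tmul, mul_one, mul_assoc, h])

theorem contract₃_mk (φ φ' : B.rightDual) (v x : U) (q : U ⊗[k] U) :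
    contract₃ hl φ φ' v (Submodule.mkQ _ (x ⊗ₜ q)) = φ.1 x * upperContract φ'
      ((LinearEquiv.ofBijective B.galoisLeft hl).symm (B.mk₂ (q * (1 ⊗ₜ v)))) := rfl

theorem contract₃_assoc (φ φ' : B.rightDual) (v y : U) (q : U ⊗[k] U) :
    contract₃ hl φ φ' v (Submodule.mkQ _ (TensorProduct.assoc k U U U (q ⊗ₜ y))) =
      contract₃ hl φ φ' 1 (Submodule.mkQ _ (TensorProduct.assoc k U U U (q ⊗ₜ (y * v)))) := by
  induction q with
  | zero => simp
  | add p q hp hq => simp only [TensorProduct.add_tmul, map_add, hp, hq]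
  | tmul a b =>
    rw [TensorProduct.assoc_tmul, TensorProduct.assoc_tmul, contract₃_mk, contract₃_mk]
    simp

/-- Applying Δ to the first leg does not touch the last one, so v may be multiplied in before or
after. -/
theorem contract₃_comulLeft (φ φ' : B.rightDual) (v : U) (r : U ⊗[k] U) :
    contract₃ hl φ φ' v (comulLeft B.comul _ _ r) =
      contract₃ hl φ φ' 1 (comulLeft B.comul _ _ (r * (1 ⊗ₜ v))) := by
  induction r with
  | zero => simp
  | add p q hp hq => simp only [add_mul, map_add, hp, hq]
  | tmul x y =>
    obtain ⟨q, hq⟩ := B.exists_rep x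
    rw [Algebra.TensorProduct.tmul_mul_tmul, mul_one, comulLeft, TensorProduct.lift.tmul,
      TensorProduct.lift.tmul, LinearMap.comp_apply, ← hq]
    exact contract₃_assoc hl φ φ' v y q

/-- Here the inverse cancels: α_ℓ⁻¹(y₁ ⊗ y₂v) = y ⊗ v, which contracts to ε(y t(φ'(v))). -/
theorem contract₃_comulRight (φ φ' : B.rightDual) (v : U) (r : U ⊗[k] U) :
    contract₃ hl φ φ' v (comulRight _ _ B.comul r) =
      LinearMap.mul' k A (TensorProduct.map φ.1 B.counit
        (r * (1 ⊗ₜ B.target (op (φ'.1 v))))) := by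
  induction r with
  | zero => simp
  | add p q hp hq => simp only [add_mul, map_add, hp, hq]
  | tmul x y =>
    obtain ⟨q, hq⟩ := B.exists_rep y
    rw [comulRight, TensorProduct.lift.tmul, LinearMap.flip_apply, LinearMap.comp_apply, ← hq]
    change contract₃ hl φ φ' v (Submodule.mkQ _ (x ⊗ₜ q)) = _
    have h : (LinearEquiv.ofBijective B.galoisLeft hl).symm (B.mk₂ (q * (1 ⊗ₜ v))) =
        B.hopfMk (y ⊗ₜ v) := by
      refine (LinearEquiv.symm_apply_eq _).2 ?_
      change _ = B.galoisLeft (B.hopfMk (y ⊗ₜ v))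
      rw [galoisLeft_mk, ← hq, rightAct_mk]
    rw [contract₃_mk, h, upperContract_tmul]
    simp

/-- `v ⊗ w ↦ φ(v₁) φ'(α_ℓ⁻¹(v₂ ⊗ w))` -/
def contract₂ (φ φ' : B.rightDual) : BTensor
    (fun a : A => LinearMap.mulLeft k (B.target (op a)))
    (fun a : A => LinearMap.mulLeft k (B.source a)) →ₗ[k] A :=
  Submodule.liftQ _ (contract₃ hl φ φ' 1 ∘ₗ comulLeft B.comul _ _)
    (balancedRel_le_ker _ _ _ fun a x y => by
      obtain ⟨q, hq⟩ := B.exists_rep x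
      have h := B.comul_bimodule 1 a x q hq
      simp only [map_one, one_mul] at h
      simp only [LinearMap.mulLeft_apply, LinearMap.comp_apply, comulLeft,
        TensorProduct.lift.tmul]
      rw [h, ← hq]
      change contract₃ hl φ φ' 1 (Submodule.mkQ _ (TensorProduct.assoc k U U U (_ ⊗ₜ y))) =
        contract₃ hl φ φ' 1 (Submodule.mkQ _ (TensorProduct.assoc k U U U (q ⊗ₜ _)))
      clear h hq
      induction q with
      | zero => simp
      | add p q hp hq => simp only [mul_add, TensorProduct.add_tmul, map_add, hp, hq]
      | tmul b c =>
        rw [Algebra.TensorProduct.tmul_mul_tmul, one_mul, TensorProduct.assoc_tmul,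
          TensorProduct.assoc_tmul, contract₃_mk, contract₃_mk,
          ← Algebra.TensorProduct.one_def, mul_one, mul_one, B.mk₂_balanced])

theorem contract₂_mk (φ φ' : B.rightDual) (p : U ⊗[k] U) :
    contract₂ hl φ φ' (B.mk₂ p) = contract₃ hl φ φ' 1 (comulLeft B.comul _ _ p) := rfl

-- The contracted form of u₁ ⊗ u₂₊ ⊗ u₂₋ = u₊₁ ⊗ u₊₂ ⊗ u₋. By coassociativity the left side is φ(x₁)
-- ε(x₂ t(φ'(y))), the value of φ · 1 = φ at x t(φ'(y)).
include hB in
theorem contract₂_galoisLeft_tmul (pr : B.RightFGProjective) (φ φ' : B.rightDual) (x y : U) :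
    contract₂ hl φ φ' (B.galoisLeft (B.hopfMk (x ⊗ₜ y))) = φ.1 (x * B.target (op (φ'.1 y))) := by
  obtain ⟨r, hr⟩ := B.exists_rep x
  rw [galoisLeft_mk, ← hr, rightAct_mk, contract₂_mk, ← contract₃_comulLeft, B.coassoc x r hr,
    contract₃_comulRight]
  -- The unit of the dual is ε, so the remaining counit is a second convolution factor, and the
  -- scalars are 1 and φ'(y).
  have h : (φ * 1).1 (x * B.source (φ'.1 y * 1)) = LinearMap.mul' k A
      (TensorProduct.map φ.1 B.counit (r * (B.source 1 ⊗ₜ[k] B.source (φ'.1 y)))) :=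
    (hB.dualPairing pr).ev_mul_mul_source hB φ 1 x 1 (φ'.1 y) hr
  rw [mul_one, mul_one, map_one B.source, hB.source_eq_target] at h
  exact h.symm

/-- At u the left side is φ₁(u₁) S(φ₂)(u₂), which is `contract₂` at u ⊗ 1 = α_ℓ(u₊ ⊗ u₋). It
therefore equals φ₁(u₊ t(φ₂(u₋))) = φ(u₊u₋) = φ(s(ε(u))) = φ(1)ε(u). -/
theorem mul_antipode (φ : B.rightDual) (p : B.rightDual ⊗[k] B.rightDual)
    (hp : (rightDualData pr).mk₂ p = (rightDualData pr).comul φ) :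
    LinearMap.mul' k B.rightDual (TensorProduct.map LinearMap.id (hB.antipode hl) p) =
      (rightDualData pr).target (op (φ.1 1)) := by
  refine rightDual_ext fun u => ?_
  have hp' := (rightDualData_comul_iff pr φ p).1 hp
  obtain ⟨r, hr⟩ := B.exists_rep u
  obtain ⟨I, rfl⟩ := TensorProduct.exists_finset r
  obtain ⟨q, hq⟩ := Submodule.mkQ_surjective _ (hl.translation u)
  obtain ⟨J, rfl⟩ := TensorProduct.exists_finset q
  have hJ := hl.galoisLeft_of_rep hq
  have key : ∀ p, (LinearMap.mul' k B.rightDual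
      (TensorProduct.map LinearMap.id (hB.antipode hl) p)).1 u =
      ∑ j ∈ J, B.rightEval j.1 j.2 p := by
    intro p
    induction p with
    | zero =>
      rw [map_zero, map_zero]
      simp
    | add p q hp hq =>
      rw [map_add, map_add]
      refine (congrArg₂ (· + ·) hp hq).trans ?_
      simp only [map_add, Finset.sum_add_distrib]
    | tmul x y =>
      have h : contract₂ hl x y (B.mk₂ (u ⊗ₜ 1)) = ∑ j ∈ J, B.rightEval j.1 j.2 (x ⊗ₜ y) := by
        rw [← hJ, map_sum, map_sum, map_sum]
        exact Finset.sum_congr rfl fun j _ => hB.contract₂_galoisLeft_tmul hl pr x y j.1 j.2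
      rw [← h, contract₂_mk, comulLeft, TensorProduct.lift.tmul, LinearMap.comp_apply, ← hr]
      change (x * hB.antipode hl y).1 u = contract₃ hl x y 1 (Submodule.mkQ _
        (TensorProduct.assoc k U U U ((∑ i ∈ I, i.1 ⊗ₜ[k] i.2) ⊗ₜ 1)))
      rw [hB.mul_apply_of_rep _ _ hr, TensorProduct.sum_tmul, map_sum, map_sum, map_sum]
      refine Finset.sum_congr rfl fun i _ => ?_
      rw [TensorProduct.assoc_tmul, contract₃_mk, ← Algebra.TensorProduct.one_def, mul_one]
      rfl
  rw [key]
  simp only [hp']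
  have h := mul_eq_of_galoisLeft_eq _ _ hJ
  rw [rightContract_tmul, mul_one, map_sum] at h
  simp only [LinearMap.mul'_apply] at h
  rw [← map_sum, h]
  change φ.1 (B.source (B.counit u)) = φ.1 1 * B.counit u
  rw [← mul_one (B.source _), hB.rightDual_source_mul, hB.base_comm]

/-! ### The full Hopf algebroid and the comparison with the left dual. -/

/-- The dual of a cocommutative left Hopf algebroid as a full Hopf algebroid. -/
def fullHopfAlgebroid : FullHopfAlgebroid k A A B.rightDual where
  left := (hB.dualPairing pr).leftBialgebroid hB
  right := (hB.dualPairing pr).rightBialgebroid hB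
  antipode := hB.antipode hl
  source_counit_target b := by
    change (rightDualData pr).target (op (b * B.counit 1)) = (rightDualData pr).target (op b)
    rw [B.counit_one, mul_one]
  target_counit_source b := by
    change (rightDualData pr).source (B.counit (1 * B.source b)) = (rightDualData pr).source b
    rw [one_mul, ← mul_one (B.source b), counit_source_mul, B.counit_one, mul_one]
  source_counit_target' b := by
    change (rightDualData pr).source (B.counit (1 * B.source b)) = (rightDualData pr).source b
    rw [one_mul, ← mul_one (B.source b), counit_source_mul, B.counit_one, mul_one]
  target_counit_source' b := by
    change (rightDualData pr).target (op (b * B.counit 1)) = (rightDualData pr).target (op b)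
    rw [B.counit_one, mul_one]
  -- The left and right coproducts have the same representatives, so mixed coassociativity is again
  -- associativity in `U`.
  coassoc_left_right h p q hp hq :=
    (hB.dualPairing pr).comulLeft_eq_comulRight
      (fun _ _ => hB.rightDual_mul_comm _ _) (fun _ _ => hB.rightDual_mul_comm _ _)
      (fun _ _ => rfl) (fun _ _ => rfl) _ _
      (fun x p => ((rightDualData pr).oppositeOfComm_comul_iff hB.rightDual_mul_comm x p).1)
      (fun _ _ => id) hp
      (((rightDualData pr).oppositeOfComm_comul_iff hB.rightDual_mul_comm h q).1 hq)
  coassoc_right_left h p q hp hq :=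
    (hB.dualPairing pr).comulLeft_eq_comulRight
      (fun _ _ => rfl) (fun _ _ => rfl)
      (fun _ _ => hB.rightDual_mul_comm _ _) (fun _ _ => hB.rightDual_mul_comm _ _) _ _
      (fun _ _ => id)
      (fun x p => ((rightDualData pr).oppositeOfComm_comul_iff hB.rightDual_mul_comm x p).1)
      (((rightDualData pr).oppositeOfComm_comul_iff hB.rightDual_mul_comm h p).1 hp) hq
  antipode_bimodule a b φ := by
    -- In the opposite structure source and target are exchanged: the left target is s^* and the
    -- left source is t^*.
    change hB.antipode hl ((rightDualData pr).source a * φ * (rightDualData pr).target (op b)) =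
      (rightDualData pr).source b * hB.antipode hl φ * (rightDualData pr).target (op a)
    rw [hB.rightDual_mul_comm _ φ, antipode_mul_source_mul_target,
      hB.rightDual_mul_comm _ (hB.antipode hl φ)]
  antipode_mul φ p hp := hB.antipode_mul hl pr φ p
    (((rightDualData pr).oppositeOfComm_comul_iff hB.rightDual_mul_comm φ p).1 hp)
  mul_antipode φ p hp := hB.mul_antipode hl pr φ p hp

/-- Both coproducts are characterised by their values against pairs (u, v), where the conditions
agree up to the flip. -/
theorem leftDualData_comul_iff_flip (pl : B.LeftFGProjective) (ψ : B.leftDual)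
    (p : B.leftDual ⊗[k] B.leftDual) :
    (leftDualData pl).mk₂ p = (leftDualData pl).comul ψ ↔
      (rightDualData pr).mk₂ (flipCongr hB.dualEquiv.symm p) =
        (rightDualData pr).comul (hB.dualEquiv.symm ψ) := by
  rw [leftDualData_comul_iff, rightDualData_comul_iff]
  refine forall₂_congr fun u v => ?_
  rw [← hB.rightEval_dualEquiv]
  rfl

include pr in
/-- The left dual of a cocommutative left bialgebroid as a right bialgebroid. -/
def leftDualBialgebroid (pl : B.LeftFGProjective) : RightBialgebroid k A B.leftDual :=
  ((hB.dualPairing pr).rightBialgebroid hB).ofFlip (leftDualData pl) hB.dualEquiv.symm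
    hB.base_comm hB.leftDual_mul_comm
    (fun _ => rightDual_ext fun _ => hB.base_comm _ _)
    (fun a => rightDual_ext fun u =>
      congrArg (fun c => B.counit (u * c)) (hB.source_eq_target a).symm)
    (fun _ => rfl) (hB.leftDualData_comul_iff_flip pr pl)

include hB in
/-- A commutative base is isomorphic to its opposite. -/
def baseEquiv : A ≃ₐ[k] Aᵐᵒᵖ :=
  AlgEquiv.ofLinearEquiv (MulOpposite.opLinearEquiv k) rfl
    (fun a b => congrArg op (hB.base_comm a b))

theorem isHom_coop (pl : B.LeftFGProjective) :
    (rightDualData pr).IsHom (leftDualData pl).coop (hB.dualEquiv : B.rightDual →ₐ[k] B.leftDual)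
      (hB.baseEquiv : A →ₐ[k] Aᵐᵒᵖ) where
  source a := leftDual_ext fun u => congrArg (fun c => B.counit (u * c)) (hB.source_eq_target a)
  target a := leftDual_ext fun u => hB.base_comm _ _
  counit _ := rfl
  comul φ p hp := by
    have h : (leftDualData pl).mk₂ (flipCongr hB.dualEquiv p) =
        (leftDualData pl).comul (hB.dualEquiv φ) := by
      rw [leftDualData_comul_iff_flip hB pr, hB.dualEquiv.symm_apply_apply, ← hp]
      congr 1
      exact flipCongr_symm_flipCongr _ p
    exact ((leftDualData pl).coop_comul h).trans (congrArg _ (comm_flipCongr _ p))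

end LeftBialgebroid.IsCocommutative

end Bgd

end

theorem mainTheorem5 {k A U : Type*} [CommRing k] [Ring A] [Algebra k A] [Ring U] [Algebra k U]
    (B : Bgd.LeftBialgebroid k A U) (hB : B.IsCocommutative) :
    (B.IsLeftHopf ↔ B.IsRightHopf) ∧
    ∀ (hl : B.IsLeftHopf) (hr : B.IsRightHopf)
      (pl : B.LeftFGProjective) (pr : B.RightFGProjective),
      -- the left dual `U_*` is a right bialgebroid
      (∃ W : Bgd.RightBialgebroid k A B.leftDual,
        W.toRightBialgebroidData = Bgd.LeftBialgebroid.leftDualData pl) ∧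
      -- `(U^*, A) = ((U_*)_coop, A^op)` through the maps which are the identity on the functions
      -- `U → A` and on `A`; `F` is this identification
      ∃ (F : B.rightDual ≃ₐ[k] B.leftDual) (f : A ≃ₐ[k] Aᵐᵒᵖ),
        (∀ φ u, (F φ).1 u = φ.1 u) ∧ (∀ a, f a = MulOpposite.op a) ∧
        (Bgd.LeftBialgebroid.rightDualData pr).IsHom (Bgd.LeftBialgebroid.leftDualData pl).coop
          (F : B.rightDual →ₐ[k] B.leftDual) (f : A →ₐ[k] Aᵐᵒᵖ) ∧
        -- `U^*` is a full Hopf algebroid: its right bialgebroid is the right dual, its left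
        -- bialgebroid the opposite of it on the same commutative ring
        ∃ (hcomm : ∀ φ φ' : B.rightDual, φ * φ' = φ' * φ)
          (H : Bgd.FullHopfAlgebroid k A A B.rightDual),
          H.right.toRightBialgebroidData = Bgd.LeftBialgebroid.rightDualData pr ∧
          H.left.toLeftBialgebroidData =
            (Bgd.LeftBialgebroid.rightDualData pr).oppositeOfComm hcomm ∧
          -- the antipode is `S^*` and it is `S_*`, and it is involutive
          (∀ φ, F (H.antipode φ) = Bgd.LeftBialgebroid.upperS hl φ) ∧
          (∀ ψ, H.antipode (F.symm ψ) = Bgd.LeftBialgebroid.lowerS hr ψ) ∧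
          (∀ φ, H.antipode (H.antipode φ) = φ) := by
  refine ⟨hB.isLeftHopf_iff_isRightHopf, fun hl hr pl pr => ⟨⟨hB.leftDualBialgebroid pr pl, rfl⟩,
    hB.dualEquiv, hB.baseEquiv, fun _ _ => rfl, fun _ => rfl, hB.isHom_coop pr pl,
    hB.rightDual_mul_comm, hB.fullHopfAlgebroid hl pr, rfl, rfl,
    fun φ => hB.dualEquiv.apply_symm_apply _, fun ψ => ?_, hB.antipode_antipode hl⟩⟩
  -- Every ψ in `U_*` comes from `U^*`, so the comparison of S_* with the antipode may be made
  -- there.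
  have h := hB.lowerS_dualEquiv hl hr (hB.dualEquiv.symm ψ)
  rw [AlgEquiv.apply_symm_apply] at h
  exact h.symm
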